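/- A multi-pass quantum streaming algorithm over the alphabet $[n]=\{1,\dots,n\}$ has as its whole memory a fixed number of classical bits and a fixed number of qubits. It starts with fixed classical contents and a fixed quantum state. When a stream element $x_j$ arrives, it applies to the qubits a unitary, and to the classical memory a function, each determined by $x_j$ and the current classical memory. At the end of each pass it applies a unitary chosen by the classical memory, measures a set (possibly empty) of qubits chosen by the classical memory in the computational basis, and updates the classical memory using the outcome. After the last pass all qubits are measured, and the output is a real number determined by the outcome and the classical memory. Its space is the total number of qubits and classical bits. For a stream $A=\langle x_1,\dots,x_m\rangle$ with $x_j\in[n]$ let $p_i=|\{j : x_j=i\}|/m$ and $H(p)=\sum_{i=1}^n -p_i\log p_i$, where $\log$ is the base-2 logarithm and $0\log 0=0$. **Theorem.** There is a universal constant $C>0$ such that for all integers $m,n\ge 1$ and all $\varepsilon,\delta\in(0,1)$ there is a quantum streaming algorithm over $[n]$ (depending only on $m,n,\varepsilon,\delta$) which makes at most $$C\cdot\frac{\max\{1,\log(1/\delta)\}\,\sqrt{\log m}}{\varepsilon}$$ passes, uses at most $$C\left(\log m+\log n+\log\frac1\varepsilon\right)$$ qubits and classical bits in total, and which on every stream of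 length $m$ over $[n]$ outputs a value $\widehat H$ with $$\Pr\big[(1-\varepsilon)H(p)\le \widehat H\le(1+\varepsilon)H(p)\big]\ge 1-\delta .$$ -/

import Mathlib

/-- Contents of a register of `k` (classical) bits; also the labels of the computational basis of
`k` qubits. -/
abbrev BitString (k : ℕ) : Type := Fin k → Bool

/-- A (not necessarily normalised) state vector of `k` qubits in the computational basis. -/
abbrev QubitVector (k : ℕ) : Type := BitString k → ℂ

/-- Unitary operators on `k` qubits. -/
abbrev QubitUnitary (k : ℕ) : Type := Matrix.unitaryGroup (BitString k) ℂ

/-- The basis vector `|0…0⟩`. -/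
def zeroKet (k : ℕ) : QubitVector k := Pi.single (fun _ => false) 1

/-- The action of a unitary on a state vector. -/
def applyUnitary {k : ℕ} (U : QubitUnitary k) (ψ : QubitVector k) : QubitVector k :=
  (U : Matrix (BitString k) (BitString k) ℂ).mulVec ψ

/-- The unnormalised state after the qubits in `M` were measured in the computational basis with
outcome `y`. -/
def collapse {k : ℕ} (M : Finset (Fin k)) (y : M → Bool) (ψ : QubitVector k) : QubitVector k :=
  fun z => if ∀ i : M, z i = y i then ψ z else 0

/-- A multi-pass quantum streaming algorithm over the alphabet `Fin n`.

Its whole memory consists of `bits` classical bits and `qubits` qubits. Every operation is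
determined by the memory and, while the stream is being read, by the current element: there is no
free access to the position in the stream or to the number of the current pass.

* At the beginning the classical memory is `init` and the qubits are in the state `prep |0…0⟩`.
* When the element `x` arrives and the classical memory is `c`, the unitary `gate c x` is applied
  to the qubits and the classical memory becomes `update c x`.
* At the end of each pass, with classical memory `c`, the unitary `endGate c` is applied, the qubits
  in `measured c` (possibly none) are measured in the computational basis, and the classical
  memory becomes `endUpdate c y`, where `y` is the outcome.
* After `passes` passes all qubits are measured in the computational basis; on outcome `y`, with
  classical memory `c`, the output is `output c y`. -/
structure QuantumStreamingAlgorithm (n : ℕ) where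
  qubits : ℕ
  bits : ℕ
  passes : ℕ
  init : BitString bits
  prep : QubitUnitary qubits
  update : BitString bits → Fin n → BitString bits
  gate : BitString bits → Fin n → QubitUnitary qubits
  endGate : BitString bits → QubitUnitary qubits
  measured : BitString bits → Finset (Fin qubits)
  endUpdate : (c : BitString bits) → (measured c → Bool) → BitString bits
  output : BitString bits → BitString qubits → ℝ

namespace QuantumStreamingAlgorithm

variable {n : ℕ} (A : QuantumStreamingAlgorithm n)

/-- Processing one element of the stream. -/
def step (p : BitString A.bits × QubitVector A.qubits) (x : Fin n) :
    BitString A.bits × QubitVector A.qubits :=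
  (A.update p.1 x, applyUnitary (A.gate p.1 x) p.2)

/-- Reading the whole stream once, in order. -/
def scan (l : List (Fin n)) (p : BitString A.bits × QubitVector A.qubits) :
    BitString A.bits × QubitVector A.qubits :=
  l.foldl A.step p

/-- Born rule: the weight with which the algorithm, started with classical memory `c` and
unnormalised state vector `ψ`, ends with an output in `S` after `t` passes over the stream `l`.
The weight of a sequence of measurement outcomes is the squared norm of the vector obtained by
applying the corresponding unitaries and projections. -/
noncomputable def weight (l : List (Fin n)) (S : Set ℝ) :
    ℕ → BitString A.bits → QubitVector A.qubits → ℝ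
  | 0, c, ψ => ∑ y, S.indicator (fun _ => ‖ψ y‖ ^ 2) (A.output c y)
  | t + 1, c, ψ =>
      let p := A.scan l (c, ψ)
      ∑ y : A.measured p.1 → Bool,
        weight l S t (A.endUpdate p.1 y)
          (collapse (A.measured p.1) y (applyUnitary (A.endGate p.1) p.2))

/-- The probability that the output on the stream `⟨x 0, …, x (m - 1)⟩` lies in `S`. -/
noncomputable def outputProb {m : ℕ} (x : Fin m → Fin n) (S : Set ℝ) : ℝ :=
  A.weight (List.ofFn x) S A.passes A.init (applyUnitary A.prep (zeroKet A.qubits))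

/-- On the stream `x` the algorithm outputs an `(ε, δ)`-approximation of `V`. -/
def IsApproximation {m : ℕ} (x : Fin m → Fin n) (ε δ V : ℝ) : Prop :=
  1 - δ ≤ A.outputProb x (Set.Icc ((1 - ε) * V) ((1 + ε) * V))

end QuantumStreamingAlgorithm

/-- The empirical probability `m_i / m` of the symbol `i` in a stream of length `m`. -/
noncomputable def empiricalProb {m n : ℕ} (x : Fin m → Fin n) (i : Fin n) : ℝ :=
  ((Finset.univ.filter fun j => x j = i).card : ℝ) / m

/-- Shannon entropy, in bits, of the empirical distribution of a stream. -/
noncomputable def streamEntropy {m n : ℕ} (x : Fin m → Fin n) : ℝ :=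
  ∑ i, -(empiricalProb x i * Real.logb 2 (empiricalProb x i))

/-! Let `z` be the survivor of a Boyer–Moore vote on the stream and `N` the number of elements other
than `z`. Then H(p) = h + (N/m)·A, where h ≥ 0 is the contribution of `z`, computable from `N` and
m, and A is the mean of log(m / count) over the elements other than `z` (`streamEntropy_eq`). Each
symbol other than `z` fills at most half of the stream, so the averaged terms lie between 1 and log
m (`info_bounds`). Hence a relative error ε for A suffices, and since A / log m ≥ 1 / log m,
amplitude estimation achieves it with O(√(log m) / ε) iterations.

One iteration is a product of two reflections: one about the uniform superposition of `N` positions,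
and a data-dependent one which loads the symbol at a position, counts its occurrences, reflects a
flag by an angle with cosine 1 - 2 log(m / count) / log m, and uncomputes. It costs four passes. The
data-dependent reflection has expectation μ = 1 - 2A / log m in the start state
(`streamQuery_expectation`). The phase is estimated with a Hann window on a clock register of size
D. The mean squared error of the outcome as an estimate of μ is O((1 - μ²) / D² + 1 / D⁴); only the
inner products of iterates one and two steps apart enter, and nothing is diagonalised
(`sum_phaseWeight_mul_sq_le`). By Chebyshev a single run is good with probability at least 63/64
(`sum_bad_runProb_le`).

The space bound is independent of δ, so the outcomes of the roughly log(1/δ) runs cannot be stored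
for a median. They are combined online by two majority votes over the cells of two shifted grids on
the logarithmic scale (`abs_sub_le_of_grid_vote`). The vote counters for k runs need O(log k) bits,
which is affordable for k ≤ n; when log(1/δ) ≥ n there are enough passes to count every symbol
separately and deterministically (`exists_exact_algorithm`). -/

open Matrix ComplexConjugate

/-! ### Abstract streaming machines and their realisation with bits and qubits. -/

namespace QuantumStreamingAlgorithm

variable {n : ℕ} (B : QuantumStreamingAlgorithm n) {l : List (Fin n)} {T : Set ℝ} {t : ℕ}

theorem sum_univ_restrict {k : ℕ} {M : Finset (Fin k)} (hM : M = Finset.univ)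
    (f : (M → Bool) → ℝ) : ∑ y, f y = ∑ z : BitString k, f fun i => z i := by
  subst hM
  refine Fintype.sum_equiv (Equiv.arrowCongr (Equiv.subtypeUnivEquiv fun _ => Finset.mem_univ _)
    (Equiv.refl Bool)) _ _ fun y => ?_
  congr 1

theorem collapse_univ {k : ℕ} {M : Finset (Fin k)} (hM : M = Finset.univ) (z : BitString k)
    (φ : QubitVector k) : collapse M (fun i => z i) φ = Pi.single z (φ z) := by
  subst hM
  ext w
  by_cases hw : w = z
  · simp [collapse, hw]
  · rw [Pi.single_eq_of_ne hw, collapse, if_neg]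
    exact fun h => hw (funext fun i => h ⟨i, Finset.mem_univ i⟩)

theorem weight_succ_of_measured_univ {c : BitString B.bits} {ψ : QubitVector B.qubits}
    {p : BitString B.bits × QubitVector B.qubits} (h : B.scan l (c, ψ) = p) (hM : B.measured p.1 = Finset.univ) :
    B.weight l T (t + 1) c ψ = ∑ z : BitString B.qubits,
      B.weight l T t (B.endUpdate p.1 fun i => z i)
        (Pi.single z (applyUnitary (B.endGate p.1) p.2 z)) := by
  subst h
  simp only [weight]
  rw [sum_univ_restrict hM]
  simp only [collapse_univ hM]

theorem weight_succ_of_measured_empty {c : BitString B.bits} {ψ : QubitVector B.qubits}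
    {p : BitString B.bits × QubitVector B.qubits} (h : B.scan l (c, ψ) = p) (hM : B.measured p.1 = ∅) :
    B.weight l T (t + 1) c ψ =
      B.weight l T t (B.endUpdate p.1 fun _ => false) (applyUnitary (B.endGate p.1) p.2) := by
  subst h
  simp only [weight]
  have : IsEmpty (B.measured (B.scan l (c, ψ)).1) := by rw [hM]; infer_instance
  rw [Fintype.sum_unique]
  congr 1
  · exact congrArg _ (Subsingleton.elim _ _)
  · ext w; simp [collapse]

end QuantumStreamingAlgorithm

/-- A streaming machine with classical state space `S` and a quantum register with basis labels
`Q`, which at the end of a pass measures either all of the quantum register or nothing. -/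
structure StreamMachine (n : ℕ) (S Q : Type) [Fintype Q] [DecidableEq Q] where
  update : S → Fin n → S
  gate : S → Fin n → Matrix.unitaryGroup Q ℂ
  endGate : S → Matrix.unitaryGroup Q ℂ
  measures : S → Bool
  endUpdate : S → S
  outcomeUpdate : S → Q → S
  output : S → ℝ

namespace StreamMachine

variable {n : ℕ} {S Q : Type} [Fintype Q] [DecidableEq Q] (A : StreamMachine n S Q)

/-- Reading the whole stream once. -/
def scan (l : List (Fin n)) (p : S × (Q → ℂ)) : S × (Q → ℂ) :=
  l.foldl (fun p x => (A.update p.1 x, (A.gate p.1 x).1.mulVec p.2)) p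

/-- The Born weight of ending with an output in `T` after the given number of passes. -/
noncomputable def weight (l : List (Fin n)) (T : Set ℝ) : ℕ → S → (Q → ℂ) → ℝ
  | 0, s, ψ => ∑ q, T.indicator (fun _ => ‖ψ q‖ ^ 2) (A.output s)
  | t + 1, s, ψ =>
      let p := A.scan l (s, ψ)
      let φ := (A.endGate p.1).1.mulVec p.2
      if A.measures p.1 then ∑ q, weight l T t (A.outcomeUpdate p.1 q) (Pi.single q (φ q))
      else weight l T t (A.endUpdate p.1) φ

theorem exists_bitString_encoding [Finite S] [Nonempty S] {b : ℕ} (h : Nat.card S ≤ 2 ^ b) :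
    ∃ (enc : S → BitString b) (dec : BitString b → S), ∀ s, dec (enc s) = s := by
  have := Fintype.ofFinite S
  have hc : Fintype.card S ≤ Fintype.card (BitString b) := by
    simpa [Nat.card_eq_fintype_card] using h
  obtain ⟨f⟩ := Function.Embedding.nonempty_of_card_le hc
  exact ⟨f, Function.invFun f, Function.leftInverse_invFun f.injective⟩

theorem exists_bitString_equiv {Q : Type} [Fintype Q] {k : ℕ} (h : Fintype.card Q = 2 ^ k) (q₀ : Q) :
    ∃ e : Q ≃ BitString k, e q₀ = fun _ => false := by
  obtain ⟨e⟩ := Fintype.card_eq.1 (show Fintype.card Q = Fintype.card (BitString k) by simp [h])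
  -- The transposition moves `q₀` to the zero string, so that no preparation unitary is needed.
  exact ⟨e.trans (Equiv.swap (e q₀) fun _ => false), by simp⟩

/-- Relabelling the basis of a unitary. -/
def relabel {k : ℕ} (e : Q ≃ BitString k) (U : Matrix.unitaryGroup Q ℂ) : QubitUnitary k :=
  ⟨U.1.submatrix e.symm e.symm, by
    have h := Matrix.mem_unitaryGroup_iff.1 U.2
    rw [Matrix.mem_unitaryGroup_iff, star_eq_conjTranspose, conjTranspose_submatrix,
      submatrix_mul_equiv, ← star_eq_conjTranspose, h, submatrix_one_equiv]⟩

theorem applyUnitary_relabel {k : ℕ} (e : Q ≃ BitString k) (U : Matrix.unitaryGroup Q ℂ)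
    (ψ : Q → ℂ) : applyUnitary (relabel e U) (ψ ∘ e.symm) = (U.1.mulVec ψ) ∘ e.symm := by
  ext z
  simp only [applyUnitary, relabel, mulVec, dotProduct, submatrix_apply, Function.comp]
  exact Equiv.sum_comp e.symm (fun q => U.1 (e.symm z) q * ψ q)

/-- The machine as a quantum streaming algorithm. -/
noncomputable def toAlgorithm {k b : ℕ} (passes : ℕ) (s₀ : S) (enc : S → BitString b)
    (dec : BitString b → S) (e : Q ≃ BitString k) : QuantumStreamingAlgorithm n where
  qubits := k
  bits := b
  passes := passes
  init := enc s₀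
  prep := 1
  update c x := enc (A.update (dec c) x)
  gate c x := relabel e (A.gate (dec c) x)
  endGate c := relabel e (A.endGate (dec c))
  measured c := if A.measures (dec c) then Finset.univ else ∅
  endUpdate c y :=
    if A.measures (dec c) then
      enc (A.outcomeUpdate (dec c) (e.symm fun i =>
        if h : i ∈ (if A.measures (dec c) then Finset.univ else ∅ : Finset (Fin k)) then y ⟨i, h⟩
        else false))
    else enc (A.endUpdate (dec c))
  output c _ := A.output (dec c)

/-- Only codes of genuine states are ever reached, so a left inverse of `enc` suffices and the
number of states need not be a power of two. -/
theorem toAlgorithm_scan {k b : ℕ} (passes : ℕ) (s₀ : S) (enc : S → BitString b)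
    (dec : BitString b → S) (hdec : ∀ s, dec (enc s) = s) (e : Q ≃ BitString k)
    (l : List (Fin n)) (s : S) (ψ : Q → ℂ) :
    (A.toAlgorithm passes s₀ enc dec e).scan l (enc s, ψ ∘ e.symm) =
      (enc (A.scan l (s, ψ)).1, (A.scan l (s, ψ)).2 ∘ e.symm) := by
  induction l generalizing s ψ with
  | nil => rfl
  | cons x l ih =>
    simp only [QuantumStreamingAlgorithm.scan, scan, List.foldl_cons] at ih ⊢
    rw [← ih]
    congr 1
    simp only [QuantumStreamingAlgorithm.step, toAlgorithm, hdec, applyUnitary_relabel]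

theorem toAlgorithm_endUpdate_of_measures {k b : ℕ} (passes : ℕ) (s₀ : S) (enc : S → BitString b)
    (dec : BitString b → S) (e : Q ≃ BitString k) (c : BitString b) (z : BitString k)
    (h : A.measures (dec c) = true) :
    (A.toAlgorithm passes s₀ enc dec e).endUpdate c (fun i => z (i.1 : Fin k)) =
      enc (A.outcomeUpdate (dec c) (e.symm z)) := by
  change (if A.measures (dec c) then enc (A.outcomeUpdate (dec c) (e.symm fun i =>
    if _ : i ∈ (if A.measures (dec c) then Finset.univ else ∅ : Finset (Fin k)) then z i
        else false)) else enc (A.endUpdate (dec c))) = _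
  simp [h]

theorem toAlgorithm_endUpdate_of_not_measures {k b : ℕ} (passes : ℕ) (s₀ : S)
    (enc : S → BitString b) (dec : BitString b → S) (e : Q ≃ BitString k) (c : BitString b)
    (h : ¬ A.measures (dec c) = true) (y) :
    (A.toAlgorithm passes s₀ enc dec e).endUpdate c y = enc (A.endUpdate (dec c)) :=
  if_neg h

theorem toAlgorithm_weight {k b : ℕ} (passes : ℕ) (s₀ : S) (enc : S → BitString b)
    (dec : BitString b → S) (hdec : ∀ s, dec (enc s) = s) (e : Q ≃ BitString k)
    (l : List (Fin n)) (T : Set ℝ) (t : ℕ) (s : S) (ψ : Q → ℂ) :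
    (A.toAlgorithm passes s₀ enc dec e).weight l T t (enc s) (ψ ∘ e.symm) =
      A.weight l T t s ψ := by
  induction t generalizing s ψ with
  | zero =>
    simp only [QuantumStreamingAlgorithm.weight, weight]
    refine Fintype.sum_equiv e.symm _ _ fun y => ?_
    simp [toAlgorithm, hdec]
  | succ t ih =>
    have hscan := toAlgorithm_scan A passes s₀ enc dec hdec e l s ψ
    have hw : A.weight l T (t + 1) s ψ =
      let p := A.scan l (s, ψ)
      let φ := (A.endGate p.1).1.mulVec p.2
      if A.measures p.1 then ∑ q, A.weight l T t (A.outcomeUpdate p.1 q) (Pi.single q (φ q))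
      else A.weight l T t (A.endUpdate p.1) φ := rfl
    rw [hw]
    generalize A.scan l (s, ψ) = p at hscan ⊢
    obtain ⟨s', ψ'⟩ := p
    dsimp only at hscan ⊢
    have hg : applyUnitary ((A.toAlgorithm passes s₀ enc dec e).endGate (enc s')) (ψ' ∘ e.symm) =
        ((A.endGate s').1.mulVec ψ') ∘ e.symm := by
      refine Eq.trans ?_ (applyUnitary_relabel e _ _)
      rw [← congrArg A.endGate (hdec s')]
      rfl
    by_cases hm : A.measures s'
    · have hm' : A.measures (dec (enc s')) = true := by rw [hdec, hm]
      refine (QuantumStreamingAlgorithm.weight_succ_of_measured_univ _ hscan (if_pos hm')).trans ?_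
      rw [if_pos hm, ← Equiv.sum_comp e.symm]
      refine Finset.sum_congr rfl fun z _ => ?_
      rw [← ih]
      refine congr_arg₂ _ ?_ ?_
      · refine (toAlgorithm_endUpdate_of_measures A passes s₀ enc dec e _ z hm').trans ?_
        rw [hdec]
      · have hz := congrFun hg z
        refine (congrArg (Pi.single z) hz).trans ?_
        ext w
        simp only [Pi.single_apply, Function.comp]
        exact if_congr e.symm.injective.eq_iff.symm rfl rfl
    · have hm' : ¬ A.measures (dec (enc s')) = true := by rw [hdec]; exact hm
      refine (QuantumStreamingAlgorithm.weight_succ_of_measured_empty _ hscan (if_neg hm')).trans ?_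
      rw [if_neg hm, ← ih]
      refine congr_arg₂ _ ?_ hg
      refine (toAlgorithm_endUpdate_of_not_measures A passes s₀ enc dec e _ hm' _).trans ?_
      rw [hdec]

/-- Every machine with a small state space is realised by a quantum streaming algorithm. -/
theorem exists_algorithm [Finite S] {k b : ℕ} (hQ : Fintype.card Q = 2 ^ k)
    (hS : Nat.card S ≤ 2 ^ b) (passes : ℕ) (s₀ : S) (q₀ : Q) :
    ∃ B : QuantumStreamingAlgorithm n, B.passes = passes ∧ B.qubits = k ∧ B.bits = b ∧
      ∀ {m : ℕ} (x : Fin m → Fin n) (T : Set ℝ),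
        B.outputProb x T = A.weight (List.ofFn x) T passes s₀ (Pi.single q₀ 1) := by
  have : Nonempty S := ⟨s₀⟩
  obtain ⟨enc, dec, hdec⟩ := exists_bitString_encoding hS
  obtain ⟨e, he⟩ := exists_bitString_equiv hQ q₀
  refine ⟨A.toAlgorithm passes s₀ enc dec e, rfl, rfl, rfl, fun x T => ?_⟩
  rw [← toAlgorithm_weight A passes s₀ enc dec hdec e]
  show (A.toAlgorithm passes s₀ enc dec e).weight _ _ _ (enc s₀) (applyUnitary 1 (zeroKet k)) = _
  refine congrArg _ ?_
  have h1 : applyUnitary (1 : QubitUnitary k) (zeroKet k) = zeroKet k := one_mulVec _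
  refine h1.trans ?_
  ext z
  simp only [zeroKet, Function.comp, Pi.single_apply, Equiv.symm_apply_eq, he]

end StreamMachine

/-! ### Majority votes with a single counter. -/

/-- One step of the Boyer–Moore majority vote, where elements vote for their key. -/
def majorityStep {α κ : Type*} [DecidableEq κ] (f : α → κ) (p : α × ℕ) (x : α) : α × ℕ :=
  if p.2 = 0 then (x, 1) else if f x = f p.1 then (p.1, p.2 + 1) else (p.1, p.2 - 1)

/-- The Boyer–Moore majority vote. -/
def majorityVote {α κ : Type*} [DecidableEq κ] (f : α → κ) (a : α) (l : List α) : α × ℕ :=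
  l.foldl (majorityStep f) (a, 0)

section MajorityVote

variable {α κ : Type*} [DecidableEq κ] (f : α → κ) (a : α)

theorem majorityVote_append_singleton (l : List α) (x : α) :
    majorityVote f a (l ++ [x]) = majorityStep f (majorityVote f a l) x := by
  simp [majorityVote]

/-- The elements read split into pairs with different keys and `c` unpaired elements, all with the
key of the candidate, where `c` is the counter. Each pair contains a given key at most once, which
yields all three bounds. -/
theorem majorityVote_invariant (l : List α) :
    (majorityVote f a l).2 ≤ l.countP (fun x => f x = f (majorityVote f a l).1) ∧
    2 * l.countP (fun x => f x = f (majorityVote f a l).1) ≤ l.length + (majorityVote f a l).2 ∧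
    ∀ v, v ≠ f (majorityVote f a l).1 →
      2 * l.countP (fun x => f x = v) + (majorityVote f a l).2 ≤ l.length := by
  induction l using List.reverseRecOn with
  | nil => simp [majorityVote]
  | append_singleton l x ih =>
    rw [majorityVote_append_singleton]
    generalize majorityVote f a l = p at ih ⊢
    obtain ⟨b, c⟩ := p
    obtain ⟨h1, h2, h3⟩ := ih
    dsimp only at h1 h2 h3
    simp only [majorityStep]
    split_ifs with h0 hx
    · subst h0
      refine ⟨by simp, ?_, fun v hv => ?_⟩
      · by_cases hb : f x = f b
        · simp [List.countP_append, hb]; omega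
        · have := h3 (f x) hb
          simp [List.countP_append]; omega
      · have : 2 * l.countP (fun x => f x = v) ≤ l.length := by
          by_cases hb : v = f b
          · rw [hb]; omega
          · exact h3 v hb
        have hv' : f x ≠ v := fun h => hv h.symm
        simp [List.countP_append, hv']; omega
    · refine ⟨?_, ?_, fun v hv => ?_⟩
      · simp [List.countP_append, hx]; omega
      · simp [List.countP_append, hx]; omega
      · have := h3 v hv
        have hv' : f x ≠ v := fun h => hv (h.symm.trans hx)
        simp [List.countP_append, hv']; omega
    · refine ⟨?_, ?_, fun v hv => ?_⟩
      · simp [List.countP_append, hx]; omega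
      · simp [List.countP_append, hx]; omega
      · have := h3 v hv
        simp only [List.countP_append, List.countP_cons, List.countP_nil, List.length_append,
          List.length_cons, List.length_nil]
        split_ifs <;> omega

theorem majorityVote_count_le (l : List α) : (majorityVote f a l).2 ≤ l.length :=
  (majorityVote_invariant f a l).1.trans List.countP_le_length

/-- The candidate of the vote with the larger margin. -/
def strongerCandidate {α : Type*} (p q : α × ℕ) : α := if q.2 ≤ p.2 then p.1 else q.1

/-- If the elements outside of a set are few, and the keys `f` or the keys `g` are constant on the
set, then the candidate with the larger margin shares one of its keys with an element of the set. -/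
theorem exists_good_of_strongerCandidate (g : α → κ) (good : α → Prop) [DecidablePred good]
    (l : List α) (hbad : 3 * l.countP (fun x => ¬ good x) < l.length)
    (hfg : (∃ v, ∀ x, good x → f x = v) ∨ (∃ v, ∀ x, good x → g x = v)) :
    ∃ x, good x ∧
      (f x = f (strongerCandidate (majorityVote f a l) (majorityVote g a l)) ∨
        g x = g (strongerCandidate (majorityVote f a l) (majorityVote g a l))) := by
  -- A key shared by all good elements occurs at least `length - bad` times; the invariant then
  -- forces the margin up to `length - 2 * bad`, and the case of a different winner is
  -- contradictory.
  have margin : ∀ (f : α → κ), (∃ v, ∀ x, good x → f x = v) →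
      l.length ≤ (majorityVote f a l).2 + 2 * l.countP (fun x => ¬ good x) := by
    rintro f ⟨v, hv⟩
    obtain ⟨-, h2, h3⟩ := majorityVote_invariant f a l
    have hc : l.countP (fun x => good x) ≤ l.countP (fun x => f x = v) :=
      List.countP_mono_left fun x _ hx => by simpa using hv x (by simpa using hx)
    have hl := List.length_eq_countP_add_countP (fun x => decide (good x)) (l := l)
    simp only [decide_eq_true_eq] at hl
    by_cases h : v = f (majorityVote f a l).1
    · rw [h] at hc; omega
    · have := h3 v h; omega
  -- The counter bounds the number of elements with the winning key from below; once it exceeds the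
  -- number of bad elements, one of them is good. The larger margin is at least `length - 2 * bad >
  -- bad`, even if it belongs to the key that is not constant on the good elements.
  have exists_good : ∀ (f : α → κ), l.countP (fun x => ¬ good x) < (majorityVote f a l).2 →
      ∃ x, good x ∧ f x = f (majorityVote f a l).1 := by
    intro f hf
    by_contra! hno
    have h1 := (majorityVote_invariant f a l).1
    have : l.countP (fun x => f x = f (majorityVote f a l).1) ≤ l.countP (fun x => ¬ good x) :=
      List.countP_mono_left fun x _ hx => by
        simp only [decide_eq_true_eq] at hx ⊢
        exact fun hg => hno x hg hx
    omega
  unfold strongerCandidate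
  split_ifs with h
  · obtain ⟨x, hx, hx'⟩ := exists_good f (by
      rcases hfg with hf | hg
      · have := margin f hf; omega
      · have := margin g hg; omega)
    exact ⟨x, hx, Or.inl hx'⟩
  · obtain ⟨x, hx, hx'⟩ := exists_good g (by
      rcases hfg with hf | hg
      · have := margin f hf; omega
      · have := margin g hg; omega)
    exact ⟨x, hx, Or.inr hx'⟩

end MajorityVote

/-! ### Votes over the cells of two shifted grids, replacing a median. -/

section Grid

/-- The index of the cell of width `2 w` containing `t`, in one of two grids shifted by `w`. -/
noncomputable def gridCell (w : ℝ) (shift : ℤ) (t : ℝ) : ℤ := (⌊t / w⌋ + shift) / 2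

theorem abs_sub_le_of_gridCell_eq {w : ℝ} (hw : 0 < w) {shift : ℤ} {s t : ℝ}
    (h : gridCell w shift s = gridCell w shift t) : |s - t| ≤ 2 * w := by
  unfold gridCell at h
  have h1 : ⌊s / w⌋ ≤ ⌊t / w⌋ + 1 := by omega
  have h2 : ⌊t / w⌋ ≤ ⌊s / w⌋ + 1 := by omega
  have h1' : (⌊s / w⌋ : ℝ) ≤ ⌊t / w⌋ + 1 := by exact_mod_cast h1
  have h2' : (⌊t / w⌋ : ℝ) ≤ ⌊s / w⌋ + 1 := by exact_mod_cast h2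
  have a1 := Int.floor_le (s / w)
  have a2 := Int.lt_floor_add_one (s / w)
  have b1 := Int.floor_le (t / w)
  have b2 := Int.lt_floor_add_one (t / w)
  have hs : s = s / w * w := by field_simp
  have ht : t = t / w * w := by field_simp
  rw [abs_le]
  constructor <;> nlinarith

/-- An interval of length `w` meets at most two consecutive intervals `b`, `b + 1` of the grid of
mesh `w`. A cell is a pair of neighbours, and the parity of `b` decides which shift pairs these two.
-/
theorem gridCell_const {w : ℝ} (hw : 0 < w) (c : ℝ) :
    (∃ v, ∀ t, |t - c| ≤ w / 2 → gridCell w 0 t = v) ∨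
      ∃ v, ∀ t, |t - c| ≤ w / 2 → gridCell w 1 t = v := by
  set b := ⌊(c - w / 2) / w⌋ with hb
  have key : ∀ t, |t - c| ≤ w / 2 → ⌊t / w⌋ = b ∨ ⌊t / w⌋ = b + 1 := by
    intro t ht
    rw [abs_le] at ht
    have h1 : b ≤ ⌊t / w⌋ := by
      apply Int.floor_le_floor
      gcongr
      linarith
    have h2 : ⌊t / w⌋ ≤ b + 1 := by
      have : t / w ≤ (c - w / 2) / w + 1 := by
        rw [div_add_one hw.ne']
        gcongr
        linarith
      calc ⌊t / w⌋ ≤ ⌊(c - w / 2) / w + 1⌋ := Int.floor_le_floor this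
        _ = b + 1 := by rw [Int.floor_add_one]
    omega
  rcases Int.even_or_odd' b with ⟨k, hk | hk⟩
  · refine Or.inl ⟨k, fun t ht => ?_⟩
    unfold gridCell
    rcases key t ht with h | h <;> rw [h] <;> omega
  · refine Or.inr ⟨k + 1, fun t ht => ?_⟩
    unfold gridCell
    rcases key t ht with h | h <;> rw [h] <;> omega

/-- Combining many estimates of `c`, more than two thirds of which are good. -/
theorem abs_sub_le_of_grid_vote {α : Type*} (val : α → ℝ) {w : ℝ} (hw : 0 < w) (c : ℝ)
    (a : α) (good : α → Prop) [DecidablePred good] (hgood : ∀ x, good x → |val x - c| ≤ w / 2)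
    (l : List α) (hbad : 3 * l.countP (fun x => ¬ good x) < l.length) :
    |val (strongerCandidate (majorityVote (fun x => gridCell w 0 (val x)) a l)
      (majorityVote (fun x => gridCell w 1 (val x)) a l)) - c| ≤ 5 / 2 * w := by
  obtain ⟨x, hx, h⟩ := exists_good_of_strongerCandidate (fun x => gridCell w 0 (val x)) a
    (fun x => gridCell w 1 (val x)) good l hbad (by
      rcases gridCell_const hw c with ⟨v, hv⟩ | ⟨v, hv⟩
      · exact Or.inl ⟨v, fun x hx => hv _ (hgood x hx)⟩
      · exact Or.inr ⟨v, fun x hx => hv _ (hgood x hx)⟩)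
  have h1 := hgood x hx
  rcases h with h | h
  -- The distance `w / 2` of the good element from `c` and the cell width `2 * w` add up to `5 / 2 *
  -- w`.
  · have h2 := abs_sub_le_of_gridCell_eq hw h
    rw [abs_le] at h1 h2 ⊢
    constructor <;> linarith
  · have h2 := abs_sub_le_of_gridCell_eq hw h
    rw [abs_le] at h1 h2 ⊢
    constructor <;> linarith

end Grid

/-! ### Amplification by independent repetitions. -/

section Repetition

open scoped Classical in
/-- The probability, when `t` further independent outcomes with weights `P` are appended to `h`,
that the resulting list satisfies `G`. -/
noncomputable def repeatProb {α : Type*} [Fintype α] (P : α → ℝ) (G : List α → Prop) :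
    ℕ → List α → ℝ
  | 0, h => if G h then 1 else 0
  | t + 1, h => ∑ a, P a * repeatProb P G t (h ++ [a])

/-- An exponential moment bound. Each outcome contributes a factor 64 if it is bad and 1 otherwise,
with mean at most `1 + 64 / 64 = 2`. Failure requires at least `k / 3` bad outcomes, hence a product
of at least `4 ^ k`, so starting from the empty list it has probability at most `2 ^ k / 4 ^ k`. -/
theorem one_sub_le_repeatProb {α : Type*} [Fintype α] (P : α → ℝ) (G : List α → Prop)
    (hP : ∀ a, 0 ≤ P a) (hP1 : ∑ a, P a = 1) (good : α → Prop)
    [DecidablePred good] (hbad : ∑ a with ¬ good a, P a ≤ 1 / 64) {k : ℕ}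
    (hG : ∀ l : List α, l.length = k → 3 * l.countP (fun a => ¬ good a) < k → G l) (t : ℕ)
    (h : List α) (ht : h.length + t = k) :
    1 - 2 ^ t * (64 : ℝ) ^ h.countP (fun a => ¬ good a) / 4 ^ k ≤ repeatProb P G t h := by
  induction t generalizing h with
  | zero =>
    simp only [repeatProb]
    split_ifs with hh
    · have : (0 : ℝ) ≤ 2 ^ 0 * (64 : ℝ) ^ h.countP (fun a => ¬ good a) / 4 ^ k := by positivity
      linarith
    · have hc : k ≤ 3 * h.countP (fun a => ¬ good a) := by
        by_contra! hlt
        exact hh (hG h (by omega) hlt)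
      have : (1 : ℝ) ≤ 2 ^ 0 * (64 : ℝ) ^ h.countP (fun a => ¬ good a) / 4 ^ k := by
        rw [one_le_div (by positivity), pow_zero, one_mul,
          show (64 : ℝ) = 4 ^ 3 by norm_num, ← pow_mul]
        exact pow_le_pow_right₀ (by norm_num) hc
      linarith
  | succ t ih =>
    simp only [repeatProb]
    set B : ℝ := 2 ^ t * (64 : ℝ) ^ h.countP (fun a => ¬ good a) / 4 ^ k with hB
    have hB0 : 0 ≤ B := by positivity
    have step : ∀ a, P a * (1 - (if good a then 1 else 64) * B) ≤
        P a * repeatProb P G t (h ++ [a]) := by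
      intro a
      refine mul_le_mul_of_nonneg_left ((le_of_eq ?_).trans (ih (h ++ [a]) (by simp; omega))) (hP a)
      rw [List.countP_append, List.countP_singleton]
      by_cases ha : good a
      · simp [ha, hB]
      · simp [ha, hB, pow_succ]; ring
    have hsum : ∑ a, P a * (if good a then (1 : ℝ) else 64) ≤ 2 := by
      have : ∀ a, P a * (if good a then (1 : ℝ) else 64) ≤
          P a + 64 * (if ¬ good a then P a else 0) := by
        intro a
        have := hP a
        by_cases ha : good a
        · simp [ha]
        · simp [ha]; linarith
      calc _ ≤ ∑ a, (P a + 64 * (if ¬ good a then P a else 0)) := Finset.sum_le_sum fun a _ => this a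
        _ = 1 + 64 * ∑ a with ¬ good a, P a := by
            rw [Finset.sum_add_distrib, hP1, ← Finset.mul_sum, Finset.sum_filter]
        _ ≤ 2 := by linarith
    calc 1 - 2 ^ (t + 1) * (64 : ℝ) ^ h.countP (fun a => ¬ good a) / 4 ^ k = 1 - 2 * B := by
          rw [hB]; ring
      _ ≤ 1 - (∑ a, P a * (if good a then (1 : ℝ) else 64)) * B := by nlinarith
      _ = ∑ a, P a * (1 - (if good a then 1 else 64) * B) := by
          simp only [mul_sub, mul_one, Finset.sum_sub_distrib, hP1, Finset.sum_mul, mul_assoc]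
      _ ≤ _ := Finset.sum_le_sum fun a _ => step a

end Repetition

/-! ### Phase estimation with a Hann window and its variance. -/

section PhaseEstimation

variable {D : ℕ} [NeZero D]

/-- The matrix of the inverse discrete Fourier transform. -/
noncomputable def fourierMatrix (D : ℕ) [NeZero D] : Matrix (ZMod D) (ZMod D) ℂ :=
  fun k y => ((√(D : ℝ))⁻¹ : ℝ) * ZMod.stdAddChar (-(k * y))

theorem sum_stdAddChar_mul (b : ZMod D) :
    ∑ k : ZMod D, ZMod.stdAddChar (k * b) = if b = 0 then (D : ℂ) else 0 := by
  rw [AddChar.sum_mulShift b (ZMod.isPrimitive_stdAddChar D), ZMod.card]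
  split_ifs <;> simp

theorem conj_stdAddChar (x : ZMod D) :
    conj (ZMod.stdAddChar x : ℂ) = ZMod.stdAddChar (-x) :=
  (AddChar.map_neg_eq_conj _ x).symm

theorem norm_stdAddChar (x : ZMod D) : ‖(ZMod.stdAddChar x : ℂ)‖ = 1 := by
  exact Circle.norm_coe (ZMod.toCircle x)

theorem fourierMatrix_mem_unitaryGroup : fourierMatrix D ∈ Matrix.unitaryGroup (ZMod D) ℂ := by
  rw [Matrix.mem_unitaryGroup_iff']
  ext y y'
  rw [Matrix.mul_apply]
  have h : ∀ k, (star (fourierMatrix D)) y k * fourierMatrix D k y' =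
      (D : ℂ)⁻¹ * ZMod.stdAddChar (k * (y - y')) := by
    intro k
    rw [star_apply, fourierMatrix, fourierMatrix, RCLike.star_def, map_mul, conj_stdAddChar,
      Complex.conj_ofReal, neg_neg]
    have hD : (((√(D : ℝ))⁻¹ : ℝ) : ℂ) * ((√(D : ℝ))⁻¹ : ℝ) = (D : ℂ)⁻¹ := by
      rw [← Complex.ofReal_mul, ← mul_inv, Real.mul_self_sqrt (Nat.cast_nonneg _)]
      simp
    rw [mul_mul_mul_comm, hD, ← AddChar.map_add_eq_mul]
    congr 2
    ring
  simp only [h, ← Finset.mul_sum, sum_stdAddChar_mul, sub_eq_zero, Matrix.one_apply]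
  have : (D : ℂ) ≠ 0 := Nat.cast_ne_zero.2 (NeZero.ne D)
  split_ifs <;> simp [this]

variable {W : Type*} [Fintype W]

/-- The characteristic function of the outcome of a measurement in the Fourier basis. -/
theorem sum_norm_sq_fourier_mul_stdAddChar (v : ZMod D → W → ℂ) (d : ZMod D) :
    ∑ w, ∑ k, ((‖∑ y, fourierMatrix D k y * v y w‖ ^ 2 : ℝ) : ℂ) * ZMod.stdAddChar (d * k) =
      ∑ y, ∑ w, v (y + d) w * conj (v y w) := by
  rw [Finset.sum_comm (s := (Finset.univ : Finset (ZMod D)))]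
  refine Finset.sum_congr rfl fun w _ => ?_
  have hD : (((√(D : ℝ))⁻¹ : ℝ) : ℂ) * ((√(D : ℝ))⁻¹ : ℝ) = (D : ℂ)⁻¹ := by
    rw [← Complex.ofReal_mul, ← mul_inv, Real.mul_self_sqrt (Nat.cast_nonneg _)]
    simp
  have h : ∀ k, ((‖∑ y, fourierMatrix D k y * v y w‖ ^ 2 : ℝ) : ℂ) * ZMod.stdAddChar (d * k) =
      ∑ y', ∑ y, (D : ℂ)⁻¹ * (v y w * conj (v y' w)) * ZMod.stdAddChar (k * (d - y + y')) := by
    intro k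
    push_cast
    rw [← Complex.mul_conj', map_sum, Finset.sum_mul_sum, Finset.sum_comm, Finset.sum_mul]
    refine Finset.sum_congr rfl fun y' _ => ?_
    rw [Finset.sum_mul]
    refine Finset.sum_congr rfl fun y _ => ?_
    rw [fourierMatrix, fourierMatrix, map_mul, map_mul, conj_stdAddChar, Complex.conj_ofReal,
      neg_neg, show k * (d - y + y') = -(k * y) + k * y' + d * k by ring,
      AddChar.map_add_eq_mul, AddChar.map_add_eq_mul, ← hD]
    ring
  simp only [h]
  rw [Finset.sum_comm]
  refine Finset.sum_congr rfl fun y' _ => ?_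
  rw [Finset.sum_comm]
  simp only [← Finset.mul_sum, sum_stdAddChar_mul]
  rw [Finset.sum_eq_single (y' + d)]
  · have : (D : ℂ) ≠ 0 := Nat.cast_ne_zero.2 (NeZero.ne D)
    simp only [show d - (y' + d) + y' = 0 by ring, if_true]
    field_simp
  · intro y _ hy
    rw [if_neg, mul_zero]
    intro h0
    apply hy
    linear_combination -h0
  · simp

/-- The distance of neighbouring roots of unity. -/
noncomputable def rootStep (D : ℕ) [NeZero D] : ℝ := ‖(ZMod.stdAddChar (1 : ZMod D) : ℂ) - 1‖

theorem rootStep_le : rootStep D ≤ 2 * Real.pi / D := by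
  unfold rootStep
  have h := ZMod.stdAddChar_coe (N := D) 1
  rw [Int.cast_one] at h
  rw [h]
  have h2 : (2 * Real.pi * Complex.I * ((1 : ℤ) : ℂ) / D : ℂ) =
      Complex.I * ((2 * Real.pi / D : ℝ) : ℂ) := by push_cast; ring
  rw [h2]
  have := Real.norm_exp_I_mul_ofReal_sub_one_le (x := 2 * Real.pi / D)
  rwa [Real.norm_of_nonneg (by positivity)] at this

/-- The smooth window function of the phase estimation, before normalisation. -/
noncomputable def hannWindow (y : ZMod D) : ℝ := 1 - (ZMod.stdAddChar y : ℂ).re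

/-- The squared norm of the window. -/
noncomputable def hannNorm (D : ℕ) [NeZero D] : ℝ := ∑ y : ZMod D, hannWindow y ^ 2

/-- The window is one minus a cosine; in its square the cosines sum to zero and the squared cosine
is dropped. -/
theorem le_hannNorm (hD : 1 < D) : (D : ℝ) ≤ hannNorm D := by
  have h0 : ∑ y : ZMod D, (ZMod.stdAddChar y : ℂ).re = 0 := by
    have := sum_stdAddChar_mul (1 : ZMod D)
    have : Fact (1 < D) := ⟨hD⟩
    simp only [mul_one, one_ne_zero, if_false] at *
    rw [← Complex.re_sum]
    simp_all
  calc (D : ℝ) = ∑ y : ZMod D, (1 - 2 * (ZMod.stdAddChar y : ℂ).re) := by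
        rw [Finset.sum_sub_distrib, ← Finset.mul_sum, h0]; simp
    _ ≤ _ := Finset.sum_le_sum fun y _ => by
        unfold hannWindow
        nlinarith [sq_nonneg (ZMod.stdAddChar y : ℂ).re]

/-- The window vanishes where the clock wraps around. This kills the wraparound term in the
correlation of shift one and all but one of those in the correlation of shift two. -/
theorem hannWindow_zero : hannWindow (0 : ZMod D) = 0 := by simp [hannWindow]

theorem hannWindow_neg (y : ZMod D) : hannWindow (-y) = hannWindow y := by
  simp [hannWindow, ← conj_stdAddChar]

theorem abs_hannWindow_sub_le (y : ZMod D) : |hannWindow (y + 2) - hannWindow y| ≤ 2 * rootStep D := by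
  have h : hannWindow (y + 2) - hannWindow y =
      -((ZMod.stdAddChar y : ℂ) * ((ZMod.stdAddChar (1 : ZMod D) + 1) *
        (ZMod.stdAddChar (1 : ZMod D) - 1))).re := by
    have : (ZMod.stdAddChar (y + 2) : ℂ) = ZMod.stdAddChar y * (ZMod.stdAddChar (1 : ZMod D)) ^ 2 := by
      rw [AddChar.map_add_eq_mul, ← one_add_one_eq_two, AddChar.map_add_eq_mul, sq]
    unfold hannWindow
    rw [this, ← Complex.neg_re, sub_sub_sub_cancel_left, ← Complex.sub_re]
    congr 1
    ring
  rw [h, abs_neg]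
  refine (Complex.abs_re_le_norm _).trans ?_
  rw [norm_mul, norm_mul, norm_stdAddChar, one_mul]
  refine mul_le_mul_of_nonneg_right ((norm_add_le _ _).trans ?_) (norm_nonneg _)
  rw [norm_stdAddChar, norm_one]
  norm_num

theorem abs_hannWindow_second_diff_le (y : ZMod D) :
    |hannWindow (y + 2) - 2 * hannWindow (y + 1) + hannWindow y| ≤ rootStep D ^ 2 := by
  have h : hannWindow (y + 2) - 2 * hannWindow (y + 1) + hannWindow y =
      -((ZMod.stdAddChar y : ℂ) * (ZMod.stdAddChar (1 : ZMod D) - 1) ^ 2).re := by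
    have h2 : (ZMod.stdAddChar (y + 2) : ℂ) =
        ZMod.stdAddChar y * (ZMod.stdAddChar (1 : ZMod D)) ^ 2 := by
      rw [AddChar.map_add_eq_mul, ← one_add_one_eq_two, AddChar.map_add_eq_mul, sq]
    have h1 : (ZMod.stdAddChar (y + 1) : ℂ) =
        ZMod.stdAddChar y * (ZMod.stdAddChar (1 : ZMod D)) := AddChar.map_add_eq_mul _ _ _
    have e : (ZMod.stdAddChar y : ℂ) * (ZMod.stdAddChar (1 : ZMod D) - 1) ^ 2 =
        ZMod.stdAddChar (y + 2) - (2 : ℝ) * ZMod.stdAddChar (y + 1) + ZMod.stdAddChar y := by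
      rw [h2, h1]; push_cast; ring
    rw [e, Complex.add_re, Complex.sub_re, Complex.re_ofReal_mul]
    unfold hannWindow
    ring
  rw [h, abs_neg]
  refine (Complex.abs_re_le_norm _).trans ?_
  rw [norm_mul, norm_pow, norm_stdAddChar, one_mul]
  rfl

theorem hannWindow_one : hannWindow (1 : ZMod D) = rootStep D ^ 2 / 2 := by
  unfold hannWindow rootStep
  have h := norm_stdAddChar (1 : ZMod D)
  have h1 : Complex.normSq (ZMod.stdAddChar (1 : ZMod D) : ℂ) = 1 := by
    rw [Complex.normSq_eq_norm_sq, h]; norm_num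
  rw [← Complex.normSq_eq_norm_sq]
  rw [Complex.normSq_apply] at h1 ⊢
  simp only [Complex.sub_re, Complex.sub_im, Complex.one_re, Complex.one_im]
  nlinarith

/-- The normalised window. -/
noncomputable def windowAmp (y : ZMod D) : ℝ := hannWindow y / √(hannNorm D)

theorem sum_windowAmp_sq (hD : 1 < D) : ∑ y : ZMod D, windowAmp y ^ 2 = 1 := by
  have h : 0 < hannNorm D := lt_of_lt_of_le (by positivity) (le_hannNorm hD)
  simp only [windowAmp, div_pow, Real.sq_sqrt h.le, ← Finset.sum_div]
  exact div_self h.ne'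

theorem sum_sq_div_hannNorm_le (hD : 1 < D) (f : ZMod D → ℝ) {b : ℝ} (hf : ∀ y, |f y| ≤ b) :
    ∑ y, (f y / √(hannNorm D)) ^ 2 ≤ b ^ 2 := by
  have hZ := le_hannNorm hD
  have h : 0 < hannNorm D := lt_of_lt_of_le (by positivity) hZ
  have hb : ∑ y : ZMod D, f y ^ 2 ≤ D * b ^ 2 := by
    calc _ ≤ ∑ _y : ZMod D, b ^ 2 := Finset.sum_le_sum fun y _ => sq_le_sq' (abs_le.1 (hf y)).1 (abs_le.1 (hf y)).2
      _ = _ := by simp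
  simp only [div_pow, Real.sq_sqrt h.le, ← Finset.sum_div]
  rw [div_le_iff₀ h]
  nlinarith [sq_nonneg b]

/-- Autocorrelation of the window. -/
noncomputable def windowCorr (D : ℕ) [NeZero D] (d : ZMod D) : ℝ :=
  ∑ y : ZMod D, windowAmp (y + d) * windowAmp y

/-- The squared norm of the difference of the window and its shift by two is `2 - 2 * windowCorr D
2`. -/
theorem one_sub_windowCorr_two_le (hD : 1 < D) :
    1 - windowCorr D 2 ≤ 2 * rootStep D ^ 2 := by
  have h1 := sum_windowAmp_sq hD
  have h2 : ∑ y : ZMod D, windowAmp (y + 2) ^ 2 = 1 := by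
    rw [← h1]; exact Equiv.sum_comp (Equiv.addRight (2 : ZMod D)) fun y => windowAmp y ^ 2
  have h := sum_sq_div_hannNorm_le hD (fun y => hannWindow (y + 2) - hannWindow y)
    abs_hannWindow_sub_le
  have e : ∑ y : ZMod D, ((hannWindow (y + 2) - hannWindow y) / √(hannNorm D)) ^ 2 =
      2 - 2 * windowCorr D 2 := by
    calc _ = ∑ y : ZMod D, (windowAmp (y + 2) ^ 2 + windowAmp y ^ 2 -
          2 * (windowAmp (y + 2) * windowAmp y)) :=
          Finset.sum_congr rfl fun y _ => by unfold windowAmp; ring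
      _ = _ := by
          rw [Finset.sum_sub_distrib, Finset.sum_add_distrib, h1, h2, ← Finset.mul_sum]
          unfold windowCorr; ring
  rw [e] at h
  nlinarith

/-- The left side is a quarter of the squared norm of the second difference of the window. It is of
fourth order in `rootStep D` because the window is smooth; this combination is the coefficient of `μ
^ 2` in the variance that does not carry the factor `1 - μ ^ 2`. -/
theorem window_second_diff_le (hD : 1 < D) :
    3 / 2 + windowCorr D 2 / 2 - 2 * windowCorr D 1 ≤ rootStep D ^ 4 / 4 := by
  have h1 := sum_windowAmp_sq hD
  have h2 : ∑ y : ZMod D, windowAmp (y + 2) ^ 2 = 1 := by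
    rw [← h1]; exact Equiv.sum_comp (Equiv.addRight (2 : ZMod D)) fun y => windowAmp y ^ 2
  have h3 : ∑ y : ZMod D, windowAmp (y + 1) ^ 2 = 1 := by
    rw [← h1]; exact Equiv.sum_comp (Equiv.addRight (1 : ZMod D)) fun y => windowAmp y ^ 2
  have h4 : ∑ y : ZMod D, windowAmp (y + 2) * windowAmp (y + 1) = windowCorr D 1 := by
    unfold windowCorr
    rw [← Equiv.sum_comp (Equiv.addRight (1 : ZMod D)) fun y => windowAmp (y + 1) * windowAmp y]
    refine Finset.sum_congr rfl fun y _ => ?_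
    simp only [Equiv.coe_addRight]
    rw [add_assoc y 1 1, one_add_one_eq_two]
  have h := sum_sq_div_hannNorm_le hD
    (fun y => hannWindow (y + 2) - 2 * hannWindow (y + 1) + hannWindow y)
    abs_hannWindow_second_diff_le
  have e : ∑ y : ZMod D, ((hannWindow (y + 2) - 2 * hannWindow (y + 1) + hannWindow y) /
      √(hannNorm D)) ^ 2 = 6 + 2 * windowCorr D 2 - 8 * windowCorr D 1 := by
    calc _ = ∑ y : ZMod D, (windowAmp (y + 2) ^ 2 + 4 * windowAmp (y + 1) ^ 2 + windowAmp y ^ 2 +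
          2 * (windowAmp (y + 2) * windowAmp y) - 4 * (windowAmp (y + 2) * windowAmp (y + 1)) -
          4 * (windowAmp (y + 1) * windowAmp y)) :=
          Finset.sum_congr rfl fun y _ => by unfold windowAmp; ring
      _ = _ := by
          rw [Finset.sum_sub_distrib, Finset.sum_sub_distrib, Finset.sum_add_distrib,
            Finset.sum_add_distrib, Finset.sum_add_distrib, ← Finset.mul_sum, ← Finset.mul_sum,
            ← Finset.mul_sum, ← Finset.mul_sum, h1, h2, h3, h4]
          unfold windowCorr; ring
  rw [e] at h
  nlinarith

/-- This is the size of the only wraparound term that survives in the correlation of shift two. -/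
theorem windowAmp_one_sq_le (hD : 1 < D) :
    windowAmp (1 : ZMod D) ^ 2 ≤ rootStep D ^ 4 / 4 := by
  have hZ := le_hannNorm hD
  have hD' : (1 : ℝ) ≤ D := by exact_mod_cast hD.le
  have h : 0 < hannNorm D := by linarith
  rw [windowAmp, div_pow, Real.sq_sqrt h.le, hannWindow_one, div_le_iff₀ h]
  nlinarith [sq_nonneg (rootStep D ^ 2)]

theorem ZMod.val_add_natCast {y : ZMod D} {d : ℕ} (h : y.val + d < D) :
    (y + (d : ZMod D)).val = y.val + d := by
  rw [ZMod.val_add, ZMod.val_natCast, Nat.mod_eq_of_lt (a := d) (by omega), Nat.mod_eq_of_lt h]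

theorem abs_re_inner_le_one {a b : W → ℂ} (ha : ∑ w, ‖a w‖ ^ 2 = 1) (hb : ∑ w, ‖b w‖ ^ 2 = 1) :
    |(∑ w, a w * conj (b w)).re| ≤ 1 := by
  refine (Complex.abs_re_le_norm _).trans ((norm_sum_le _ _).trans ?_)
  have h : ∀ w, ‖a w * conj (b w)‖ ≤ (‖a w‖ ^ 2 + ‖b w‖ ^ 2) / 2 := by
    intro w
    rw [norm_mul, RCLike.norm_conj]
    nlinarith [sq_nonneg (‖a w‖ - ‖b w‖)]
  refine (Finset.sum_le_sum fun w _ => h w).trans ?_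
  rw [← Finset.sum_div, Finset.sum_add_distrib, ha, hb]
  norm_num

/-- The weight of the outcome `k` (together with the label `w` of the other register) when the
phase of the evolution `u` is estimated. -/
noncomputable def phaseWeight (u : ℕ → W → ℂ) (w : W) (k : ZMod D) : ℝ :=
  ‖∑ y, fourierMatrix D k y * (windowAmp y * u y.val w)‖ ^ 2

theorem sum_phaseWeight_mul_re (u : ℕ → W → ℂ) (d : ZMod D) :
    ∑ w, ∑ k, phaseWeight u w k * (ZMod.stdAddChar (d * k) : ℂ).re =
      ∑ y : ZMod D, windowAmp (y + d) * windowAmp y *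
        (∑ w, u (y + d).val w * conj (u y.val w)).re := by
  have h := congrArg Complex.re
    (sum_norm_sq_fourier_mul_stdAddChar (fun (y : ZMod D) w => windowAmp y * u y.val w) d)
  simp only [Complex.re_sum, Complex.re_ofReal_mul] at h
  unfold phaseWeight
  rw [h]
  refine Finset.sum_congr rfl fun y _ => ?_
  rw [← Complex.re_sum, ← Complex.re_ofReal_mul, Finset.mul_sum]
  congr 1
  refine Finset.sum_congr rfl fun w _ => ?_
  rw [map_mul, Complex.conj_ofReal]
  push_cast
  ring

theorem sum_phaseWeight (hD : 1 < D) (u : ℕ → W → ℂ) (hu : ∀ i, ∑ w, ‖u i w‖ ^ 2 = 1) :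
    ∑ w, ∑ k : ZMod D, phaseWeight u w k = 1 := by
  have h := sum_phaseWeight_mul_re u (0 : ZMod D)
  simp only [zero_mul, AddChar.map_zero_eq_one, Complex.one_re, mul_one, add_zero] at h
  rw [h, ← sum_windowAmp_sq hD]
  refine Finset.sum_congr rfl fun y _ => ?_
  have : (∑ w, u y.val w * conj (u y.val w)) = ((1 : ℝ) : ℂ) := by
    rw [← hu y.val]
    push_cast
    simp only [Complex.mul_conj']
  rw [this, Complex.ofReal_re, mul_one, sq]

/-- The variance of phase estimation. -/
theorem sum_phaseWeight_mul_sq_le (hD : 2 < D) (u : ℕ → W → ℂ) (hu : ∀ i, ∑ w, ‖u i w‖ ^ 2 = 1)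
    {μ : ℝ} (hμ : |μ| ≤ 1) (hu1 : ∀ i, (∑ w, u (i + 1) w * conj (u i w)).re = μ)
    (hu2 : ∀ i, (∑ w, u (i + 2) w * conj (u i w)).re = 2 * μ ^ 2 - 1) :
    ∑ w, ∑ k : ZMod D, phaseWeight u w k * ((ZMod.stdAddChar k : ℂ).re - μ) ^ 2 ≤
      rootStep D ^ 2 * (1 - μ ^ 2) + rootStep D ^ 4 / 2 := by
  have hD1 : 1 < D := by omega
  have e0 := sum_phaseWeight hD1 u hu
  have e1 : ∑ w, ∑ k : ZMod D, phaseWeight u w k * (ZMod.stdAddChar k : ℂ).re =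
      windowCorr D 1 * μ := by
    have h := sum_phaseWeight_mul_re u (1 : ZMod D)
    simp only [one_mul] at h
    rw [h, windowCorr, Finset.sum_mul]
    refine Finset.sum_congr rfl fun y _ => ?_
    by_cases hy : y.val + 1 < D
    · have := ZMod.val_add_natCast (d := 1) hy
      rw [Nat.cast_one] at this
      rw [this, hu1]
    -- At the last clock value the inner product is not controlled by `hu1`, but its coefficient is
    -- zero.
    · have hy' : y + 1 = 0 := by
        have hlt := y.val_lt
        rw [← ZMod.natCast_zmod_val y, ← Nat.cast_succ, show y.val.succ = D by omega]
        simp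
      rw [hy']
      simp [windowAmp, hannWindow_zero]
  have e2 : ∑ w, ∑ k : ZMod D, phaseWeight u w k * (ZMod.stdAddChar (2 * k) : ℂ).re ≤
      windowCorr D 2 * (2 * μ ^ 2 - 1) + 2 * windowAmp (1 : ZMod D) ^ 2 := by
    rw [sum_phaseWeight_mul_re u (2 : ZMod D), windowCorr, Finset.sum_mul]
    -- Only `y = -1` wraps around with nonzero coefficient, namely `windowAmp 1 * windowAmp (-1)`.
    -- There the inner product and `2 * μ ^ 2 - 1` both lie in `[-1, 1]`, hence differ by at most 2.
    have hterm : ∀ y : ZMod D, windowAmp (y + 2) * windowAmp y *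
        (∑ w, u (y + 2).val w * conj (u y.val w)).re ≤
        windowAmp (y + 2) * windowAmp y * (2 * μ ^ 2 - 1) +
          if y = -1 then 2 * windowAmp (1 : ZMod D) ^ 2 else 0 := by
      intro y
      have hlt := y.val_lt
      have hcast : y = ((y.val : ℕ) : ZMod D) := (ZMod.natCast_zmod_val y).symm
      by_cases hy : y.val + 2 < D
      · have := ZMod.val_add_natCast (d := 2) hy
        rw [Nat.cast_two] at this
        rw [this, hu2]
        have : (0 : ℝ) ≤ if y = -1 then 2 * windowAmp (1 : ZMod D) ^ 2 else 0 := by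
          split_ifs <;> positivity
        linarith
      · rcases (show y.val + 2 = D ∨ y.val + 1 = D by omega) with h | h
        · have hy' : y + 2 = 0 := by
            rw [hcast, ← Nat.cast_two, ← Nat.cast_add, h]; simp
          have : (0 : ℝ) ≤ if y = -1 then 2 * windowAmp (1 : ZMod D) ^ 2 else 0 := by
            split_ifs <;> positivity
          rw [hy']
          simpa [windowAmp, hannWindow_zero] using this
        · have hy' : y = -1 := by
            have : y + 1 = 0 := by
              rw [hcast, ← Nat.cast_one, ← Nat.cast_add, h]; simp
            exact eq_neg_of_add_eq_zero_left this
          rw [if_pos hy', hy', show (-1 + 2 : ZMod D) = 1 by ring]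
          have hw : windowAmp (-1 : ZMod D) = windowAmp (1 : ZMod D) := by
            simp [windowAmp, hannWindow_neg]
          rw [hw]
          have hi := abs_re_inner_le_one (hu (1 : ZMod D).val) (hu (-1 : ZMod D).val)
          have hμ2 := sq_nonneg μ
          nlinarith [(abs_le.1 hi).2, sq_nonneg (windowAmp (1 : ZMod D))]
    refine (Finset.sum_le_sum fun y _ => hterm y).trans ?_
    rw [Finset.sum_add_distrib]
    simp
  -- The double-angle formula turns the square into the characteristic function at 0, 1 and 2.
  have hX : ∀ k : ZMod D, ((ZMod.stdAddChar k : ℂ).re - μ) ^ 2 =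
      (1 / 2 + μ ^ 2) * 1 + 1 / 2 * (ZMod.stdAddChar (2 * k) : ℂ).re -
        2 * μ * (ZMod.stdAddChar k : ℂ).re := by
    intro k
    have h1 : Complex.normSq (ZMod.stdAddChar k : ℂ) = 1 := by
      rw [Complex.normSq_eq_norm_sq, norm_stdAddChar]; norm_num
    rw [Complex.normSq_apply] at h1
    rw [two_mul, AddChar.map_add_eq_mul, Complex.mul_re]
    linear_combination (1 / 2) * h1
  have expand : ∑ w, ∑ k : ZMod D, phaseWeight u w k * ((ZMod.stdAddChar k : ℂ).re - μ) ^ 2 =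
      (1 / 2 + μ ^ 2) * (∑ w, ∑ k : ZMod D, phaseWeight u w k) +
      1 / 2 * (∑ w, ∑ k : ZMod D, phaseWeight u w k * (ZMod.stdAddChar (2 * k) : ℂ).re) -
      2 * μ * (∑ w, ∑ k : ZMod D, phaseWeight u w k * (ZMod.stdAddChar k : ℂ).re) := by
    simp only [Finset.mul_sum, ← Finset.sum_add_distrib, ← Finset.sum_sub_distrib]
    refine Finset.sum_congr rfl fun w _ => Finset.sum_congr rfl fun k _ => ?_
    rw [hX]; ring
  rw [expand, e0, e1]
  have a1 := one_sub_windowCorr_two_le hD1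
  have a2 := window_second_diff_le hD1
  have a3 := windowAmp_one_sq_le hD1
  have hμ2 : μ ^ 2 ≤ 1 := (sq_le_one_iff_abs_le_one μ).2 hμ
  -- Apart from the wraparound term, the variance is `(1 - windowCorr D 2) * (1 - μ ^ 2) / 2` plus
  -- `μ ^ 2` times the second-difference expression. The factor `1 - μ ^ 2` gives the quadratic
  -- speed-up for small amplitudes.
  have b1 : (1 - windowCorr D 2) * (1 - μ ^ 2) ≤ 2 * rootStep D ^ 2 * (1 - μ ^ 2) :=
    mul_le_mul_of_nonneg_right a1 (by linarith)
  have b2 : μ ^ 2 * (3 / 2 + windowCorr D 2 / 2 - 2 * windowCorr D 1) ≤ rootStep D ^ 4 / 4 := by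
    have := mul_le_mul_of_nonneg_left a2 (sq_nonneg μ)
    nlinarith [sq_nonneg (rootStep D ^ 2)]
  linarith

end PhaseEstimation

/-! ### Unitaries on registers and the iteration of two reflections. -/

section Gates

variable {W Y : Type} [Fintype W] [DecidableEq W] [Fintype Y] [DecidableEq Y]

theorem dotProduct_star_mulVec (M : Matrix.unitaryGroup W ℂ) (a b : W → ℂ) :
    (M.1 *ᵥ b) ⬝ᵥ star (M.1 *ᵥ a) = b ⬝ᵥ star a := by
  rw [star_mulVec, dotProduct_comm, ← dotProduct_mulVec, mulVec_mulVec, ← star_eq_conjTranspose,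
    Matrix.mem_unitaryGroup_iff'.1 M.2, one_mulVec, dotProduct_comm]

theorem dotProduct_star_self_eq_one_iff {W : Type} [Fintype W] (a : W → ℂ) :
    a ⬝ᵥ star a = 1 ↔ ∑ w, ‖a w‖ ^ 2 = 1 := by
  have : a ⬝ᵥ star a = ((∑ w, ‖a w‖ ^ 2 : ℝ) : ℂ) := by
    simp only [dotProduct, Pi.star_apply, RCLike.star_def, Complex.mul_conj']
    push_cast
    rfl
  rw [this]
  exact_mod_cast Iff.rfl

/-- The permutation of the basis vectors. -/
def permGate (σ : Equiv.Perm W) : Matrix.unitaryGroup W ℂ :=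
  ⟨Equiv.Perm.permMatrix ℂ σ⁻¹, by
    rw [Matrix.mem_unitaryGroup_iff, star_eq_conjTranspose, conjTranspose_permMatrix,
      ← Matrix.permMatrix_mul]
    simp⟩

theorem permGate_mulVec (σ : Equiv.Perm W) (ψ : W → ℂ) : (permGate σ).1 *ᵥ ψ = ψ ∘ σ.symm :=
  Matrix.permMatrix_mulVec _

/-- A gate on the first register controlled by the second one. -/
def blockGate (A : Y → Matrix.unitaryGroup W ℂ) : Matrix.unitaryGroup (W × Y) ℂ :=
  ⟨Matrix.blockDiagonal fun y => (A y).1, by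
    rw [Matrix.mem_unitaryGroup_iff, star_eq_conjTranspose, blockDiagonal_conjTranspose,
      ← blockDiagonal_mul, ← blockDiagonal_one]
    congr 1
    funext y
    rw [← star_eq_conjTranspose, Matrix.mem_unitaryGroup_iff.1 (A y).2]
    rfl⟩

/-- A state of two registers, given by its components for the basis states of the second one. -/
def family (v : Y → W → ℂ) : W × Y → ℂ := fun p => v p.2 p.1

theorem blockGate_mulVec_family (A : Y → Matrix.unitaryGroup W ℂ) (v : Y → W → ℂ) :
    (blockGate A).1 *ᵥ family v = family fun y => (A y).1 *ᵥ v y := by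
  ext ⟨w, y⟩
  simp only [blockGate, family, mulVec, dotProduct, Fintype.sum_prod_type, blockDiagonal_apply]
  refine Finset.sum_congr rfl fun w' _ => ?_
  simp

/-- The reflection about a unit vector. -/
def reflectGate (s : W → ℂ) (hs : s ⬝ᵥ star s = 1) : Matrix.unitaryGroup W ℂ :=
  ⟨(2 : ℂ) • vecMulVec s (star s) - 1, by
    rw [Matrix.mem_unitaryGroup_iff, star_eq_conjTranspose, conjTranspose_sub, conjTranspose_smul,
      conjTranspose_vecMulVec, star_star, conjTranspose_one, sub_mul, mul_sub, smul_mul_smul_comm,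
      vecMulVec_mul_vecMulVec, dotProduct_comm, hs, one_mul, mul_one]
    ext i j
    simp [vecMulVec]
    ring⟩

theorem reflectGate_mulVec (s : W → ℂ) (hs : s ⬝ᵥ star s = 1) (ψ : W → ℂ) :
    (reflectGate s hs).1 *ᵥ ψ = (2 * (ψ ⬝ᵥ star s)) • s - ψ := by
  simp only [reflectGate]
  rw [sub_mulVec, one_mulVec, smul_mulVec, vecMulVec_mulVec, dotProduct_comm]
  ext i
  simp
  ring

/-- Any real unit vector can be rotated into another one that is not its opposite. -/
theorem exists_unitary_mulVec_eq {a b : W → ℂ} (ha : a ⬝ᵥ star a = 1) (hb : b ⬝ᵥ star b = 1)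
    {ρ : ℝ} (hρ : 0 ≤ ρ) (hab : a ⬝ᵥ star b = ρ) :
    ∃ M : Matrix.unitaryGroup W ℂ, M.1 *ᵥ a = b := by
  have hba : b ⬝ᵥ star a = ρ := by
    have : b ⬝ᵥ star a = star (a ⬝ᵥ star b) := by
      rw [← star_dotProduct_star, star_star]
    rw [this, hab]; simp
  have hpos : (0 : ℝ) < 2 + 2 * ρ := by linarith
  -- The unitary is the reflection about the bisector of `a` and `b`; `2 + 2 * ρ` is the squared
  -- norm of `a + b`.
  set r : ℝ := (√(2 + 2 * ρ))⁻¹ with hr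
  have hrr : (r : ℂ) * r * (2 + 2 * ρ) = 1 := by
    have : r * r * (2 + 2 * ρ) = 1 := by
      rw [hr, ← mul_inv, Real.mul_self_sqrt hpos.le, inv_mul_cancel₀ hpos.ne']
    exact_mod_cast this
  have hstar : star ((r : ℂ) • (a + b)) = (r : ℂ) • (star a + star b) := by
    rw [star_smul, star_add]; simp
  have hs : ((r : ℂ) • (a + b)) ⬝ᵥ star ((r : ℂ) • (a + b)) = 1 := by
    rw [hstar]
    simp only [smul_dotProduct, dotProduct_smul, add_dotProduct, dotProduct_add, ha, hb, hab, hba,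
      smul_eq_mul]
    linear_combination hrr
  refine ⟨reflectGate _ hs, ?_⟩
  rw [reflectGate_mulVec, hstar, dotProduct_smul, dotProduct_add, ha, hab]
  ext i
  simp only [Pi.sub_apply, Pi.smul_apply, Pi.add_apply, smul_eq_mul]
  linear_combination (a i + b i) * hrr

/-- The discrete Fourier transform of the second register. -/
noncomputable def fourierGate (W : Type) [Fintype W] [DecidableEq W] (D : ℕ) [NeZero D] :
    Matrix.unitaryGroup (W × ZMod D) ℂ :=
  ⟨Matrix.kroneckerMap (· * ·) 1 (fourierMatrix D),
    Matrix.kronecker_mem_unitary (one_mem _) fourierMatrix_mem_unitaryGroup⟩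

theorem fourierGate_mulVec_family {D : ℕ} [NeZero D] (v : ZMod D → W → ℂ) (w : W) (k : ZMod D) :
    ((fourierGate W D).1 *ᵥ family v) (w, k) = ∑ y, fourierMatrix D k y * v y w := by
  simp only [fourierGate, family, mulVec, dotProduct, Fintype.sum_prod_type, kroneckerMap_apply,
    Matrix.one_apply]
  rw [Finset.sum_eq_single w]
  · simp
  · intro w' _ hw
    simp [hw.symm]
  · simp

/-- The evolution by the product of two reflections. -/
def evolution (A B : Matrix.unitaryGroup W ℂ) (s : W → ℂ) (i : ℕ) : W → ℂ :=
  ((A * B) ^ i).1 *ᵥ s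

theorem evolution_succ (A B : Matrix.unitaryGroup W ℂ) (s : W → ℂ) (i : ℕ) :
    A.1 *ᵥ (B.1 *ᵥ evolution A B s i) = evolution A B s (i + 1) := by
  simp only [evolution, pow_succ', mulVec_mulVec, Submonoid.coe_mul, Matrix.mul_assoc]

theorem evolution_dotProduct (A B : Matrix.unitaryGroup W ℂ) (s : W → ℂ) (i d : ℕ) :
    evolution A B s (i + d) ⬝ᵥ star (evolution A B s i) = evolution A B s d ⬝ᵥ star s := by
  rw [← dotProduct_star_mulVec ((A * B) ^ i) s]
  simp only [evolution, pow_add, Submonoid.coe_mul, mulVec_mulVec]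

theorem evolution_norm (A B : Matrix.unitaryGroup W ℂ) {s : W → ℂ} (hs : s ⬝ᵥ star s = 1) (i : ℕ) :
    ∑ w, ‖evolution A B s i w‖ ^ 2 = 1 := by
  rw [← dotProduct_star_self_eq_one_iff]
  have := evolution_dotProduct A B s i 0
  rw [add_zero] at this
  rw [this]
  simpa [evolution] using hs

theorem reflectGate_mulVec_self {s : W → ℂ} (hs : s ⬝ᵥ star s = 1) :
    (reflectGate s hs).1 *ᵥ s = s := by
  rw [reflectGate_mulVec, hs, two_mul, add_smul, one_smul, add_sub_cancel_right]

theorem evolution_corr_one (B : Matrix.unitaryGroup W ℂ) {s : W → ℂ} (hs : s ⬝ᵥ star s = 1)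
    {μ : ℝ} (hμ : (B.1 *ᵥ s) ⬝ᵥ star s = μ) (i : ℕ) :
    (∑ w, evolution (reflectGate s hs) B s (i + 1) w *
      conj (evolution (reflectGate s hs) B s i w)).re = μ := by
  have h := evolution_dotProduct (reflectGate s hs) B s i 1
  have h1 : evolution (reflectGate s hs) B s 1 ⬝ᵥ star s = μ := by
    rw [← zero_add 1, ← evolution_succ]
    simp only [evolution, pow_zero, OneMemClass.coe_one, one_mulVec]
    have := dotProduct_star_mulVec (reflectGate s hs) s (B.1 *ᵥ s)
    rw [reflectGate_mulVec_self hs] at this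
    rw [this, hμ]
  rw [h1] at h
  exact (congrArg Complex.re h).trans (Complex.ofReal_re _)

/-- Since the reflection A fixes `s` and `B` is a self-inverse unitary, the correlation equals that
of `A B s` with `B s`, and expanding A as `2 s s* - 1` leaves `2 * μ ^ 2 - 1`. With
`evolution_corr_one`, these are the cosines of an angle and of its double: all that phase estimation
needs to know about the rotation. -/
theorem evolution_corr_two (B : Matrix.unitaryGroup W ℂ) (hB : B * B = 1) {s : W → ℂ}
    (hs : s ⬝ᵥ star s = 1) {μ : ℝ} (hμ : (B.1 *ᵥ s) ⬝ᵥ star s = μ) (i : ℕ) :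
    (∑ w, evolution (reflectGate s hs) B s (i + 2) w *
      conj (evolution (reflectGate s hs) B s i w)).re = 2 * μ ^ 2 - 1 := by
  have h := evolution_dotProduct (reflectGate s hs) B s i 2
  have hBB : ∀ x, B.1 *ᵥ (B.1 *ᵥ x) = x := fun x => by
    rw [mulVec_mulVec, ← Submonoid.coe_mul, hB, OneMemClass.coe_one, one_mulVec]
  have hμ' : s ⬝ᵥ star (B.1 *ᵥ s) = μ := by
    rw [← dotProduct_star_mulVec B, hBB, hμ]
  have h2 : evolution (reflectGate s hs) B s 2 ⬝ᵥ star s = ((2 * μ ^ 2 - 1 : ℝ) : ℂ) := by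
    rw [show (2 : ℕ) = 0 + 1 + 1 from rfl, ← evolution_succ, ← evolution_succ]
    simp only [evolution, pow_zero, OneMemClass.coe_one, one_mulVec]
    have e := dotProduct_star_mulVec (reflectGate s hs) s
      (B.1 *ᵥ ((reflectGate s hs).1 *ᵥ (B.1 *ᵥ s)))
    rw [reflectGate_mulVec_self hs] at e
    rw [e, ← dotProduct_star_mulVec B, hBB, reflectGate_mulVec, hμ, sub_dotProduct,
      smul_dotProduct, hμ', dotProduct_star_mulVec, hs, smul_eq_mul]
    push_cast
    ring
  rw [h2] at h
  exact (congrArg Complex.re h).trans (Complex.ofReal_re _)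

/-- A reflection of one qubit. -/
noncomputable def flagReflection (θ : ℝ) : Matrix.unitaryGroup Bool ℂ :=
  ⟨Matrix.of fun b b' => if b = b' then (if b then -(Real.cos θ : ℂ) else Real.cos θ)
      else Real.sin θ, by
    have h : (Real.cos θ : ℂ) * Real.cos θ + Real.sin θ * Real.sin θ = 1 := by
      have := Real.cos_sq_add_sin_sq θ
      rw [sq, sq] at this
      exact_mod_cast this
    rw [Matrix.mem_unitaryGroup_iff, star_eq_conjTranspose]
    ext b b'
    rw [Matrix.mul_apply]
    cases b <;> cases b' <;>
      simp [-Complex.ofReal_cos, -Complex.ofReal_sin] <;>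
      first | linear_combination h | ring⟩

theorem flagReflection_mul_self (θ : ℝ) : flagReflection θ * flagReflection θ = 1 := by
  have h : star (flagReflection θ).1 = (flagReflection θ).1 := by
    ext b b'
    cases b <;> cases b' <;>
      simp [flagReflection, star_apply, -Complex.ofReal_cos, -Complex.ofReal_sin]
  apply Subtype.ext
  have := Matrix.mem_unitaryGroup_iff.1 (flagReflection θ).2
  rw [h] at this
  exact this

theorem blockGate_mul (A B : Y → Matrix.unitaryGroup W ℂ) :
    blockGate A * blockGate B = blockGate fun y => A y * B y := by
  apply Subtype.ext
  exact (blockDiagonal_mul _ _).symm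

theorem blockGate_one : blockGate (fun _ : Y => (1 : Matrix.unitaryGroup W ℂ)) = 1 := by
  apply Subtype.ext
  exact blockDiagonal_one

end Gates

/-! ### The data-dependent reflection and its expectation. -/

section Query

/-- The work register: a flag, an index, a symbol, and a counter. -/
abbrev WorkReg (a b : ℕ) : Type := Bool × (ZMod (2 ^ a) × ZMod (2 ^ b) × ZMod (2 ^ a))

variable {a b : ℕ}

/-- Adding a function of the index to the symbol. -/
def loadPerm (g : ZMod (2 ^ a) → ZMod (2 ^ b)) : Equiv.Perm (WorkReg a b) where
  toFun p := (p.1, p.2.1, p.2.2.1 + g p.2.1, p.2.2.2)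
  invFun p := (p.1, p.2.1, p.2.2.1 - g p.2.1, p.2.2.2)
  left_inv p := by simp
  right_inv p := by simp

/-- Adding a function of the symbol to the counter. -/
def countPerm (h : ZMod (2 ^ b) → ZMod (2 ^ a)) : Equiv.Perm (WorkReg a b) where
  toFun p := (p.1, p.2.1, p.2.2.1, p.2.2.2 + h p.2.2.1)
  invFun p := (p.1, p.2.1, p.2.2.1, p.2.2.2 - h p.2.2.1)
  left_inv p := by simp
  right_inv p := by simp

/-- The unitary of `loadPerm`. -/
def loadGate (g : ZMod (2 ^ a) → ZMod (2 ^ b)) : Matrix.unitaryGroup (WorkReg a b) ℂ :=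
  permGate (loadPerm g)

/-- The unitary of `countPerm`. -/
def countGate (h : ZMod (2 ^ b) → ZMod (2 ^ a)) : Matrix.unitaryGroup (WorkReg a b) ℂ :=
  permGate (countPerm h)

theorem loadGate_mulVec_apply (g : ZMod (2 ^ a) → ZMod (2 ^ b)) (ψ : WorkReg a b → ℂ)
    (p : WorkReg a b) :
    ((loadGate g).1 *ᵥ ψ) p = ψ (p.1, p.2.1, p.2.2.1 - g p.2.1, p.2.2.2) := by
  rw [loadGate, permGate_mulVec]; rfl

theorem countGate_mulVec_apply (h : ZMod (2 ^ b) → ZMod (2 ^ a)) (ψ : WorkReg a b → ℂ)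
    (p : WorkReg a b) :
    ((countGate h).1 *ᵥ ψ) p = ψ (p.1, p.2.1, p.2.2.1, p.2.2.2 - h p.2.2.1) := by
  rw [countGate, permGate_mulVec]; rfl

theorem loadGate_mulVec_loadGate (g g' : ZMod (2 ^ a) → ZMod (2 ^ b)) (ψ : WorkReg a b → ℂ) :
    (loadGate g').1 *ᵥ ((loadGate g).1 *ᵥ ψ) = (loadGate (g + g')).1 *ᵥ ψ := by
  ext p
  simp only [loadGate_mulVec_apply, Pi.add_apply, sub_sub, add_comm (g p.2.1)]

theorem countGate_mulVec_countGate (h h' : ZMod (2 ^ b) → ZMod (2 ^ a)) (ψ : WorkReg a b → ℂ) :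
    (countGate h').1 *ᵥ ((countGate h).1 *ᵥ ψ) = (countGate (h + h')).1 *ᵥ ψ := by
  ext p
  simp only [countGate_mulVec_apply, Pi.add_apply, sub_sub, add_comm (h p.2.2.1)]

theorem loadGate_zero_mulVec (ψ : WorkReg a b → ℂ) : (loadGate 0).1 *ᵥ ψ = ψ := by
  ext p; simp [loadGate_mulVec_apply]

theorem countGate_zero_mulVec (ψ : WorkReg a b → ℂ) : (countGate 0).1 *ᵥ ψ = ψ := by
  ext p; simp [countGate_mulVec_apply]

/-- The reflection of the flag, by an angle that depends on the counter. -/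
noncomputable def flagGate (b : ℕ) (θ : ZMod (2 ^ a) → ℝ) : Matrix.unitaryGroup (WorkReg a b) ℂ :=
  blockGate fun p => flagReflection (θ p.2.2)

theorem flagGate_mulVec_apply (θ : ZMod (2 ^ a) → ℝ) (ψ : WorkReg a b → ℂ)
    (q : ZMod (2 ^ a) × ZMod (2 ^ b) × ZMod (2 ^ a)) :
    ((flagGate b θ).1 *ᵥ ψ) (false, q) =
      Real.cos (θ q.2.2) * ψ (false, q) + Real.sin (θ q.2.2) * ψ (true, q) := by
  have h := congrFun (blockGate_mulVec_family (fun p : ZMod (2 ^ a) × ZMod (2 ^ b) × ZMod (2 ^ a) =>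
    flagReflection (θ p.2.2)) fun y w => ψ (w, y)) (false, q)
  refine h.trans ?_
  simp [family, mulVec, dotProduct, flagReflection, add_comm]

/-- The data-dependent reflection of the amplitude estimation. -/
noncomputable def queryGate (g : ZMod (2 ^ a) → ZMod (2 ^ b)) (h : ZMod (2 ^ b) → ZMod (2 ^ a))
    (θ : ZMod (2 ^ a) → ℝ) : Matrix.unitaryGroup (WorkReg a b) ℂ :=
  loadGate (-g) * (countGate (-h) * (flagGate b θ * (countGate h * loadGate g)))

theorem queryGate_mulVec (g : ZMod (2 ^ a) → ZMod (2 ^ b)) (h : ZMod (2 ^ b) → ZMod (2 ^ a))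
    (θ : ZMod (2 ^ a) → ℝ) (ψ : WorkReg a b → ℂ) :
    (queryGate g h θ).1 *ᵥ ψ = (loadGate (-g)).1 *ᵥ ((countGate (-h)).1 *ᵥ
      ((flagGate b θ).1 *ᵥ ((countGate h).1 *ᵥ ((loadGate g).1 *ᵥ ψ)))) := by
  simp only [queryGate, mulVec_mulVec, Submonoid.coe_mul]

/-- Passes over the stream act alike for all clock values. Where the controlled reflections are
skipped, loading and counting have to cancel. -/
theorem uncompute_mulVec (g : ZMod (2 ^ a) → ZMod (2 ^ b)) (h : ZMod (2 ^ b) → ZMod (2 ^ a))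
    (ψ : WorkReg a b → ℂ) :
    (loadGate (-g)).1 *ᵥ ((countGate (-h)).1 *ᵥ
      ((countGate h).1 *ᵥ ((loadGate g).1 *ᵥ ψ))) = ψ := by
  rw [countGate_mulVec_countGate, add_neg_cancel, countGate_zero_mulVec, loadGate_mulVec_loadGate,
    add_neg_cancel, loadGate_zero_mulVec]

theorem loadGate_mul_loadGate (g g' : ZMod (2 ^ a) → ZMod (2 ^ b)) :
    loadGate g' * loadGate g = loadGate (g + g') := by
  apply Subtype.ext
  refine Matrix.ext_of_mulVec_single fun i => ?_
  rw [Submonoid.coe_mul, ← mulVec_mulVec, loadGate_mulVec_loadGate]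

theorem countGate_mul_countGate (h h' : ZMod (2 ^ b) → ZMod (2 ^ a)) :
    countGate h' * countGate h = countGate (h + h') := by
  apply Subtype.ext
  refine Matrix.ext_of_mulVec_single fun i => ?_
  rw [Submonoid.coe_mul, ← mulVec_mulVec, countGate_mulVec_countGate]

theorem loadGate_zero : loadGate (0 : ZMod (2 ^ a) → ZMod (2 ^ b)) = 1 := by
  apply Subtype.ext
  refine Matrix.ext_of_mulVec_single fun i => ?_
  rw [loadGate_zero_mulVec, OneMemClass.coe_one, one_mulVec]

theorem countGate_zero : countGate (0 : ZMod (2 ^ b) → ZMod (2 ^ a)) = 1 := by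
  apply Subtype.ext
  refine Matrix.ext_of_mulVec_single fun i => ?_
  rw [countGate_zero_mulVec, OneMemClass.coe_one, one_mulVec]

/-- The query is the flag reflection conjugated by loading and counting, hence an involution, as
`evolution_corr_two` requires. -/
theorem queryGate_mul_self (g : ZMod (2 ^ a) → ZMod (2 ^ b)) (h : ZMod (2 ^ b) → ZMod (2 ^ a))
    (θ : ZMod (2 ^ a) → ℝ) : queryGate g h θ * queryGate g h θ = 1 := by
  have h1 : loadGate g * loadGate (-g) = 1 := by
    rw [loadGate_mul_loadGate, neg_add_cancel, loadGate_zero]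
  have h2 : countGate h * countGate (-h) = 1 := by
    rw [countGate_mul_countGate, neg_add_cancel, countGate_zero]
  have h3 : flagGate b θ * flagGate b θ = 1 := by
    rw [flagGate, blockGate_mul]
    simp only [flagReflection_mul_self]
    exact blockGate_one
  have h1' : loadGate (-g) = (loadGate g)⁻¹ := eq_inv_of_mul_eq_one_right h1
  have h2' : countGate (-h) = (countGate h)⁻¹ := eq_inv_of_mul_eq_one_right h2
  have h3' : flagGate b θ = (flagGate b θ)⁻¹ := eq_inv_of_mul_eq_one_right h3
  unfold queryGate
  rw [h1', h2']
  calc _ = (loadGate g)⁻¹ * (countGate h)⁻¹ * (flagGate b θ * flagGate b θ) * countGate h *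
        loadGate g := by group
    _ = 1 := by rw [h3]; group

/-- The uniform superposition of the first `N` indices. -/
noncomputable def startVec (a b N : ℕ) : WorkReg a b → ℂ := fun p =>
  if p.1 = false ∧ p.2.1.val < N ∧ p.2.2.1 = 0 ∧ p.2.2.2 = 0 then (((√(N : ℝ))⁻¹ : ℝ) : ℂ) else 0

theorem sum_startVec_support {N : ℕ} (hN : N ≤ 2 ^ a) (f : WorkReg a b → ℂ) :
    (∑ p : WorkReg a b, if p.1 = false ∧ p.2.1.val < N ∧ p.2.2.1 = 0 ∧ p.2.2.2 = 0 then f p else 0)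
      = ∑ j ∈ Finset.range N, f (false, (j : ZMod (2 ^ a)), 0, 0) := by
  rw [← Finset.sum_filter]
  symm
  refine Finset.sum_bij (fun j _ => (false, (j : ZMod (2 ^ a)), 0, 0)) ?_ ?_ ?_ ?_
  · intro j hj
    have hj' := Finset.mem_range.1 hj
    simp [ZMod.val_natCast_of_lt (lt_of_lt_of_le hj' hN), hj']
  · intro j hj j' hj' h
    have hj := lt_of_lt_of_le (Finset.mem_range.1 hj) hN
    have hj' := lt_of_lt_of_le (Finset.mem_range.1 hj') hN
    simp only [Prod.mk.injEq, and_true, true_and] at h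
    rw [← ZMod.val_natCast_of_lt hj, ← ZMod.val_natCast_of_lt hj', h]
  · rintro ⟨f, k, i, r⟩ hp
    simp only [Finset.mem_filter, Finset.mem_univ, true_and] at hp
    obtain ⟨rfl, hk, rfl, rfl⟩ := hp
    exact ⟨k.val, Finset.mem_range.2 hk, by simp⟩
  · intros; rfl

theorem dotProduct_star_startVec {N : ℕ} (hN : N ≤ 2 ^ a) (ψ : WorkReg a b → ℂ) :
    ψ ⬝ᵥ star (startVec a b N) =
      (((√(N : ℝ))⁻¹ : ℝ) : ℂ) * ∑ j ∈ Finset.range N, ψ (false, (j : ZMod (2 ^ a)), 0, 0) := by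
  rw [Finset.mul_sum, ← sum_startVec_support hN
    fun p => (((√(N : ℝ))⁻¹ : ℝ) : ℂ) * ψ p]
  refine Finset.sum_congr rfl fun p _ => ?_
  simp only [startVec, Pi.star_apply]
  split_ifs
  · rw [RCLike.star_def, Complex.conj_ofReal, mul_comm]
  · simp

theorem startVec_apply {N : ℕ} (hN : N ≤ 2 ^ a) {j : ℕ} (hj : j < N) :
    startVec a b N (false, (j : ZMod (2 ^ a)), 0, 0) = (((√(N : ℝ))⁻¹ : ℝ) : ℂ) := by
  simp [startVec, ZMod.val_natCast_of_lt (lt_of_lt_of_le hj hN), hj]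

theorem inv_sqrt_mul_self {N : ℕ} :
    (((√(N : ℝ))⁻¹ : ℝ) : ℂ) * (((√(N : ℝ))⁻¹ : ℝ) : ℂ) = (N : ℂ)⁻¹ := by
  rw [← Complex.ofReal_mul, ← mul_inv, Real.mul_self_sqrt (Nat.cast_nonneg _)]
  simp

theorem startVec_norm {N : ℕ} (hN0 : 0 < N) (hN : N ≤ 2 ^ a) :
    startVec a b N ⬝ᵥ star (startVec a b N) = 1 := by
  rw [dotProduct_star_startVec hN, Finset.sum_congr rfl fun j hj =>
    startVec_apply hN (Finset.mem_range.1 hj), Finset.sum_const, Finset.card_range, nsmul_eq_mul,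
    mul_left_comm, inv_sqrt_mul_self, mul_inv_cancel₀ (Nat.cast_ne_zero.2 hN0.ne')]

/-- The index is never changed, so different indices do not interfere; each contributes the diagonal
entry `cos θ` of the flag reflection at the counter value computed for it, and equal amplitudes turn
the sum into a mean. -/
theorem queryGate_expectation {N : ℕ} (hN : N ≤ 2 ^ a)
    (g : ZMod (2 ^ a) → ZMod (2 ^ b)) (h : ZMod (2 ^ b) → ZMod (2 ^ a)) (θ : ZMod (2 ^ a) → ℝ) :
    ((queryGate g h θ).1 *ᵥ startVec a b N) ⬝ᵥ star (startVec a b N) =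
      (((∑ j ∈ Finset.range N, Real.cos (θ (h (g (j : ZMod (2 ^ a)))))) / N : ℝ) : ℂ) := by
  rw [dotProduct_star_startVec hN]
  have key : ∀ j ∈ Finset.range N,
      ((queryGate g h θ).1 *ᵥ startVec a b N) (false, (j : ZMod (2 ^ a)), 0, 0) =
        (((√(N : ℝ))⁻¹ : ℝ) : ℂ) * ((Real.cos (θ (h (g (j : ZMod (2 ^ a)))))) : ℝ) := by
    intro j hj
    rw [queryGate_mulVec, loadGate_mulVec_apply, countGate_mulVec_apply]
    dsimp only
    rw [flagGate_mulVec_apply]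
    simp only [countGate_mulVec_apply, loadGate_mulVec_apply, Pi.neg_apply, sub_neg_eq_add,
      zero_add, sub_self]
    rw [startVec_apply hN (Finset.mem_range.1 hj)]
    have : startVec a b N (true, (j : ZMod (2 ^ a)), 0, 0) = 0 := by simp [startVec]
    rw [this, mul_zero, add_zero, mul_comm]
  rw [Finset.sum_congr rfl key, ← Finset.mul_sum, ← mul_assoc, inv_sqrt_mul_self]
  push_cast
  rw [div_eq_inv_mul]

end Query

/-! ### What the passes over the stream add to the registers. -/

section Stream

variable {n A B : ℕ}

/-- What a pass over the stream, with a counter of the elements different from `z` that starts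
at `c`, adds to the symbol register for each index. -/
def loadIncr (e : Fin n → ZMod B) (z : Fin n) : List (Fin n) → ZMod A → ZMod A → ZMod B
  | [], _ => 0
  | x :: l, c => if x = z then loadIncr e z l c else Pi.single c (e x) + loadIncr e z l (c + 1)

theorem loadIncr_neg (e : Fin n → ZMod B) (z : Fin n) (l : List (Fin n)) (c : ZMod A) :
    loadIncr (-e) z l c = -loadIncr e z l c := by
  induction l generalizing c with
  | nil => simp [loadIncr]
  | cons x l ih =>
    simp only [loadIncr, ih]
    split_ifs
    · rfl
    · rw [neg_add, Pi.neg_apply, Pi.single_neg]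

/-- The counter only moves up from `c` and does not wrap around modulo `A`, so an index below `c` is
never hit. -/
theorem loadIncr_apply_of_lt (e : Fin n → ZMod B) (z : Fin n) (l : List (Fin n)) (c k : ℕ)
    (hk : k < c) (hc : c + l.countP (fun x => x ≠ z) ≤ A) :
    loadIncr e z l (c : ZMod A) (k : ZMod A) = 0 := by
  induction l generalizing c with
  | nil => simp [loadIncr]
  | cons x l ih =>
    simp only [loadIncr]
    split_ifs with hx
    · exact ih c hk (by simpa [hx] using hc)
    · have hc' : c + 1 + l.countP (fun x => x ≠ z) ≤ A := by
        rw [List.countP_cons_of_pos (by simpa using hx)] at hc; omega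
      have h := ih (c + 1) (by omega) hc'
      rw [Nat.cast_add, Nat.cast_one] at h
      rw [Pi.add_apply, h, add_zero, Pi.single_eq_of_ne]
      intro heq
      have := congrArg ZMod.val heq
      rw [ZMod.val_natCast_of_lt (by omega), ZMod.val_natCast_of_lt (by omega)] at this
      omega

theorem loadIncr_apply_self (e : Fin n → ZMod B) (z x : Fin n) (hx : x ≠ z) (l : List (Fin n))
    (c : ℕ) (hc : c + 1 + l.countP (fun x => x ≠ z) ≤ A) :
    loadIncr e z (x :: l) (c : ZMod A) (c : ZMod A) = e x := by
  have h := loadIncr_apply_of_lt e z l (c + 1) c (by omega) hc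
  rw [Nat.cast_add, Nat.cast_one] at h
  simp [loadIncr, hx, h]

/-- The indices enumerate the elements other than `z` in the order of the stream, each receiving
exactly one symbol. -/
theorem sum_loadIncr (e : Fin n → ZMod B) (z : Fin n) (l : List (Fin n)) (c : ℕ)
    (hc : c + l.countP (fun x => x ≠ z) ≤ A) (φ : ZMod B → ℝ) :
    ∑ j ∈ Finset.range (l.countP (fun x => x ≠ z)),
      φ (loadIncr e z l (c : ZMod A) ((c + j : ℕ) : ZMod A)) =
      ((l.filter (fun x => x ≠ z)).map fun x => φ (e x)).sum := by
  induction l generalizing c with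
  | nil => simp
  | cons x l ih =>
    by_cases hx : x = z
    · have h := ih c (by simpa [hx] using hc)
      simpa [hx, loadIncr] using h
    · have hp : l.countP (fun x => x ≠ z) + 1 = (x :: l).countP (fun x => x ≠ z) := by
        rw [List.countP_cons_of_pos (by simpa using hx)]
      have hc' : c + 1 + l.countP (fun x => x ≠ z) ≤ A := by omega
      rw [← hp, Finset.sum_range_succ', List.filter_cons_of_pos (by simpa using hx), List.map_cons,
        List.sum_cons, ← ih (c + 1) hc', add_comm]
      congr 1
      · rw [add_zero, loadIncr_apply_self e z x hx l c hc']
      · refine Finset.sum_congr rfl fun j hj => ?_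
        have hj := Finset.mem_range.1 hj
        congr 1
        simp only [loadIncr, if_neg hx, Pi.add_apply]
        rw [Pi.single_eq_of_ne, zero_add]
        · rw [show c + 1 + j = c + (j + 1) by omega]
          push_cast
          rfl
        · intro heq
          have := congrArg ZMod.val heq
          rw [ZMod.val_natCast_of_lt (by omega), ZMod.val_natCast_of_lt (by omega)] at this
          omega

/-- What a pass over the stream adds to the counter for each symbol. -/
def countIncr (e : Fin n → ZMod B) (v : ZMod A) (l : List (Fin n)) : ZMod B → ZMod A :=
  (l.map fun x => Pi.single (e x) v).sum

theorem countIncr_neg (e : Fin n → ZMod B) (v : ZMod A) (l : List (Fin n)) :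
    countIncr e (-v) l = -countIncr e v l := by
  induction l with
  | nil => simp [countIncr]
  | cons x l ih =>
    simp only [countIncr, List.map_cons, List.sum_cons] at ih ⊢
    rw [ih, neg_add, Pi.single_neg]

theorem countIncr_apply {e : Fin n → ZMod B} (he : Function.Injective e) (l : List (Fin n))
    (x : Fin n) : countIncr e (1 : ZMod A) l (e x) = (l.count x : ZMod A) := by
  induction l with
  | nil => simp [countIncr]
  | cons y l ih =>
    simp only [countIncr, List.map_cons, List.sum_cons] at ih ⊢
    rw [Pi.add_apply, ih, List.count_cons]
    by_cases h : y = x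
    · simp [h, add_comm]
    · rw [Pi.single_eq_of_ne (fun h' => h (he h').symm)]
      simp [h]

end Stream

/-! ### The entropy estimator as a streaming machine. -/

/-- The stages of the computation. After the passes `vote` and `tally` come the runs, each of
which consists of a pass `prepare`, four passes for each of the `D` iterations, and a pass
`finish`. -/
inductive Phase (D : ℕ) : Type where
  | vote : Phase D
  | tally : Phase D
  | prepare : Phase D
  | load (t : Fin D) : Phase D
  | count (t : Fin D) : Phase D
  | uncount (t : Fin D) : Phase D
  | unload (t : Fin D) : Phase D
  | finish : Phase D

/-- The classical memory of the entropy estimator. -/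
@[ext]
structure Memory (n a b d k : ℕ) : Type where
  phase : Phase (2 ^ d)
  sym : Fin n
  cnt : ZMod (2 ^ a)
  rest : ZMod (2 ^ a)
  last : WorkReg a b × ZMod (2 ^ d)
  vote₀ : ZMod (2 ^ d) × ZMod (k + 1)
  vote₁ : ZMod (2 ^ d) × ZMod (k + 1)

/-- A step of the majority vote with a bounded counter. -/
def storedMajorityStep {α κ : Type*} [DecidableEq κ] {M : ℕ} (f : α → κ) (p : α × ZMod M) (x : α) :
    α × ZMod M :=
  if p.2 = 0 then (x, 1) else if f x = f p.1 then (p.1, p.2 + 1) else (p.1, p.2 - 1)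

/-- Storing the counter of a vote in bounded memory. -/
def storeVote {α : Type*} (M : ℕ) (p : α × ℕ) : α × ZMod M := (p.1, (p.2 : ZMod M))

theorem storedMajorityStep_storeVote {α κ : Type*} [DecidableEq κ] {M : ℕ} (f : α → κ)
    {p : α × ℕ} (hp : p.2 < M) (x : α) :
    storedMajorityStep f (storeVote M p) x = storeVote M (majorityStep f p x) := by
  have h0 : ((p.2 : ZMod M) = 0) ↔ p.2 = 0 := by
    constructor
    · intro h
      have := congrArg ZMod.val h
      rwa [ZMod.val_natCast_of_lt hp, ZMod.val_zero] at this
    · rintro h; simp [h]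
  simp only [storedMajorityStep, storeVote, majorityStep, h0]
  split_ifs with h1 h2
  · simp
  · simp [h2]
  · simp [h2, Nat.cast_sub (Nat.one_le_iff_ne_zero.2 h1)]

theorem foldl_storedMajorityStep {α κ : Type*} [DecidableEq κ] {M : ℕ} (f : α → κ) (a : α)
    (l : List α) (hl : l.length < M) :
    l.foldl (storedMajorityStep f) (storeVote M (a, 0)) = storeVote M (majorityVote f a l) := by
  induction l using List.reverseRecOn with
  | nil => rfl
  | append_singleton l x ih =>
    have hl' : l.length < M := by simp at hl; omega
    rw [List.foldl_append, ih hl', majorityVote_append_singleton, List.foldl_cons, List.foldl_nil,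
      storedMajorityStep_storeVote]
    exact lt_of_le_of_lt (majorityVote_count_le f a l) hl'

namespace EntropyMachine

variable {n a b d k : ℕ}

/-- The symbols as contents of the symbol register. -/
def symCode (b : ℕ) (x : Fin n) : ZMod (2 ^ b) := (x.val : ZMod (2 ^ b))

theorem symCode_injective (h : n ≤ 2 ^ b) : Function.Injective (symCode b : Fin n → _) := by
  intro x y hxy
  have := congrArg ZMod.val hxy
  rw [symCode, symCode, ZMod.val_natCast_of_lt (lt_of_lt_of_le x.2 h),
    ZMod.val_natCast_of_lt (lt_of_lt_of_le y.2 h)] at this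
  exact Fin.ext this

/-- The angle whose cosine encodes the information content of a symbol of given frequency. -/
noncomputable def angle (m : ℕ) (r : ZMod (2 ^ a)) : ℝ :=
  Real.arccos (1 - 2 * (Real.logb 2 ((m : ℝ) / r.val) / Real.logb 2 m))

/-- The logarithm of the estimate for the mean information content that belongs to an outcome. -/
noncomputable def outcomeLog (m : ℕ) (y : ZMod (2 ^ d)) : ℝ :=
  Real.log ((1 - (ZMod.stdAddChar y : ℂ).re) / 2 * Real.logb 2 m)

/-- The number of indices in the superposition. -/
def support (N : ZMod (2 ^ a)) : ℕ := max N.val 1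

/-- The maximum with 1 in `support` keeps the initial superposition a unit vector when all elements
coincide. -/
theorem support_pos (N : ZMod (2 ^ a)) : 0 < support N := by unfold support; omega

theorem support_le (N : ZMod (2 ^ a)) : support N ≤ 2 ^ a :=
  max_le N.val_lt.le Nat.one_le_two_pow

/-- The state at the beginning of a run. -/
noncomputable def runState (b d : ℕ) (N : ZMod (2 ^ a)) : WorkReg a b × ZMod (2 ^ d) → ℂ :=
  family fun y => (windowAmp y : ℂ) • startVec a b (support N)

open scoped Classical in
/-- The unitary which turns the basis state `q` into the state at the beginning of a run. -/
noncomputable def prepareGate (N : ZMod (2 ^ a)) (q : WorkReg a b × ZMod (2 ^ d)) :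
    Matrix.unitaryGroup (WorkReg a b × ZMod (2 ^ d)) ℂ :=
  if h : ∃ M : Matrix.unitaryGroup (WorkReg a b × ZMod (2 ^ d)) ℂ,
    M.1 *ᵥ Pi.single q 1 = runState b d N then h.choose else 1

/-- A gate on the work register that acts if the clock register is beyond `t`. -/
def clockGate (t : ℕ) (U : Matrix.unitaryGroup (WorkReg a b) ℂ) :
    Matrix.unitaryGroup (WorkReg a b × ZMod (2 ^ d)) ℂ :=
  blockGate fun y => if t < y.val then U else 1

/-- The reflection about the initial superposition. -/
noncomputable def startReflection (b : ℕ) (N : ZMod (2 ^ a)) : Matrix.unitaryGroup (WorkReg a b) ℂ :=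
  reflectGate (startVec a b (support N)) (startVec_norm (support_pos N) (support_le N))

/-- The stage that follows when nothing was measured. -/
def nextPhase : Phase (2 ^ d) → Phase (2 ^ d)
  | .vote => .tally
  | .tally => .prepare
  | .prepare => .load ⟨0, by positivity⟩
  | .load t => .count t
  | .count t => .uncount t
  | .uncount t => .unload t
  | .unload t => if h : t.val + 1 < 2 ^ d then .load ⟨t.val + 1, h⟩ else .finish
  | .finish => .prepare

/-- The candidate of the stronger of two stored votes. -/
def storedCandidate {α : Type*} {M : ℕ} (p q : α × ZMod M) : α :=
  if q.2.val ≤ p.2.val then p.1 else q.1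

/-- The final estimate. -/
noncomputable def estimate (m N : ℕ) (t : ℝ) : ℝ :=
  -(((m - N : ℝ) / m) * Real.logb 2 ((m - N : ℝ) / m)) + N / m * Real.exp t

/-- The increment of the symbol register. -/
def loadStep (s : Memory n a b d k) (e : Fin n → ZMod (2 ^ b)) (x : Fin n) :
    ZMod (2 ^ a) → ZMod (2 ^ b) :=
  if x = s.sym then 0 else Pi.single s.cnt (e x)

/-- The update of the classical memory during a pass. -/
def update (s : Memory n a b d k) (x : Fin n) : Memory n a b d k :=
  match s.phase with
  | .vote =>
    { s with sym := (storedMajorityStep id (s.sym, s.cnt) x).1,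
             cnt := (storedMajorityStep id (s.sym, s.cnt) x).2 }
  | _ => { s with cnt := if x = s.sym then s.cnt else s.cnt + 1 }

/-- The gates during a pass. -/
def gate (s : Memory n a b d k) (x : Fin n) :
    Matrix.unitaryGroup (WorkReg a b × ZMod (2 ^ d)) ℂ :=
  match s.phase with
  | .load _ => blockGate fun _ => loadGate (loadStep s (symCode b) x)
  | .count _ => blockGate fun _ => countGate (Pi.single (symCode b x) 1)
  | .uncount _ => blockGate fun _ => countGate (Pi.single (symCode b x) (-1))
  | .unload _ => blockGate fun _ => loadGate (loadStep s (-symCode b) x)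
  | _ => 1

/-- The gate at the end of a pass. -/
noncomputable def endGate (m : ℕ) (s : Memory n a b d k) :
    Matrix.unitaryGroup (WorkReg a b × ZMod (2 ^ d)) ℂ :=
  match s.phase with
  | .prepare => prepareGate s.rest s.last
  | .count t => clockGate t (flagGate b (angle m))
  | .unload t => clockGate t (startReflection b s.rest)
  | .finish => fourierGate _ _
  | _ => 1

/-- Whether the register is measured at the end of a pass. -/
def measures (s : Memory n a b d k) : Bool :=
  match s.phase with
  | .finish => true
  | _ => false

/-- The entropy estimator. -/
noncomputable def machine (n m a b d k : ℕ) (w : ℝ) :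
    StreamMachine n (Memory n a b d k) (WorkReg a b × ZMod (2 ^ d)) where
  update := update
  gate := gate
  endGate := endGate m
  measures := measures
  endUpdate s :=
    { s with phase := nextPhase s.phase
             cnt := 0
             rest := match s.phase with
               | .tally => s.cnt
               | _ => s.rest }
  outcomeUpdate s q :=
    { s with phase := .prepare
             cnt := 0
             last := q
             vote₀ := storedMajorityStep (fun y => gridCell w 0 (outcomeLog m y)) s.vote₀ q.2
             vote₁ := storedMajorityStep (fun y => gridCell w 1 (outcomeLog m y)) s.vote₁ q.2 }
  output s := estimate m s.rest.val (outcomeLog m (storedCandidate s.vote₀ s.vote₁))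

/-- Qubits cannot be reset, but after a measurement they are in a known basis state `q`, kept in the
classical memory; a unitary chosen from `q` and `N` starts the next run. It exists because all
amplitudes of the start state are nonnegative, so its overlap with `q` is too. -/
theorem prepareGate_mulVec (hd : 1 < 2 ^ d) (N : ZMod (2 ^ a)) (q : WorkReg a b × ZMod (2 ^ d)) :
    (prepareGate N q).1 *ᵥ Pi.single q 1 = runState b d N := by
  have hex : ∃ M : Matrix.unitaryGroup (WorkReg a b × ZMod (2 ^ d)) ℂ,
      M.1 *ᵥ Pi.single q 1 = runState b d N := by
    have hval : ∃ r : ℝ, 0 ≤ r ∧ runState b d N q = r := by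
      refine ⟨windowAmp q.2 * (if q.1.1 = false ∧ q.1.2.1.val < support N ∧ q.1.2.2.1 = 0 ∧
        q.1.2.2.2 = 0 then (√(support N : ℝ))⁻¹ else 0), ?_, ?_⟩
      · refine mul_nonneg (div_nonneg ?_ (Real.sqrt_nonneg _)) (by split_ifs <;> positivity)
        have h1 := Complex.re_le_norm (ZMod.stdAddChar q.2 : ℂ)
        rw [norm_stdAddChar] at h1
        unfold hannWindow
        linarith
      · simp only [runState, family, startVec, Pi.smul_apply, smul_eq_mul]
        split_ifs <;> simp
    obtain ⟨r, hr0, hr⟩ := hval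
    refine exists_unitary_mulVec_eq (ρ := r) ?_ ?_ hr0 ?_
    · rw [single_one_dotProduct]; simp
    · rw [dotProduct_star_self_eq_one_iff, Fintype.sum_prod_type_right]
      have hs := (dotProduct_star_self_eq_one_iff _).1
        (startVec_norm (b := b) (support_pos N) (support_le N))
      rw [← sum_windowAmp_sq hd]
      refine Finset.sum_congr rfl fun y _ => ?_
      simp only [runState, family, Pi.smul_apply, smul_eq_mul, norm_mul, mul_pow,
        ← Finset.mul_sum, hs, Complex.norm_real, Real.norm_eq_abs, sq_abs, mul_one]
    · rw [single_one_dotProduct, Pi.star_apply, hr, RCLike.star_def, Complex.conj_ofReal]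
  rw [prepareGate, dif_pos hex]
  exact hex.choose_spec

end EntropyMachine

namespace StreamMachine

variable {n : ℕ} {S Q : Type} [Fintype Q] [DecidableEq Q] (A : StreamMachine n S Q)
  {l : List (Fin n)} {T : Set ℝ} {t : ℕ} {s s' : S} {ψ ψ' : Q → ℂ}

theorem scan_cons (x : Fin n) (l : List (Fin n)) (s : S) (ψ : Q → ℂ) :
    A.scan (x :: l) (s, ψ) = A.scan l (A.update s x, (A.gate s x).1 *ᵥ ψ) := rfl

theorem weight_succ_of_not_measures (h : A.scan l (s, ψ) = (s', ψ')) (hm : A.measures s' = false) :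
    A.weight l T (t + 1) s ψ = A.weight l T t (A.endUpdate s') ((A.endGate s').1 *ᵥ ψ') := by
  simp only [weight, h, hm, Bool.false_eq_true, if_false]

theorem weight_succ_of_measures (h : A.scan l (s, ψ) = (s', ψ')) (hm : A.measures s' = true) :
    A.weight l T (t + 1) s ψ = ∑ q, A.weight l T t (A.outcomeUpdate s' q)
      (Pi.single q (((A.endGate s').1 *ᵥ ψ') q)) := by
  simp only [weight, h, hm, if_true]

end StreamMachine

/-! ### The effect of the passes, of an iteration and of a run. -/

namespace EntropyMachine

variable {n m a b d k : ℕ} {w : ℝ}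

theorem one_mulVec' {Q : Type} [Fintype Q] [DecidableEq Q] (ψ : Q → ℂ) :
    (1 : Matrix.unitaryGroup Q ℂ).1 *ᵥ ψ = ψ := one_mulVec ψ

theorem cast_countP_cons (x z : Fin n) (l : List (Fin n)) (c : ZMod (2 ^ a)) :
    (if x = z then c else c + 1) + (l.countP (fun y => y ≠ z) : ZMod (2 ^ a)) =
      c + ((x :: l).countP (fun y => y ≠ z) : ZMod (2 ^ a)) := by
  rw [List.countP_cons]
  by_cases h : x = z
  · simp [h]
  · simp [h]; ring

theorem scan_tally (l : List (Fin n)) (z c N q v₀ v₁ ψ) :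
    (machine n m a b d k w).scan l (⟨.tally, z, c, N, q, v₀, v₁⟩, ψ) =
      (⟨.tally, z, c + (l.countP (fun y => y ≠ z) : ZMod (2 ^ a)), N, q, v₀, v₁⟩, ψ) := by
  induction l generalizing c with
  | nil => simp [StreamMachine.scan]
  | cons x l ih =>
    rw [StreamMachine.scan_cons, ← cast_countP_cons, ← ih]
    exact congrArg _ (Prod.ext rfl (one_mulVec' ψ))

theorem scan_prepare (l : List (Fin n)) (z c N q v₀ v₁ ψ) :
    (machine n m a b d k w).scan l (⟨.prepare, z, c, N, q, v₀, v₁⟩, ψ) =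
      (⟨.prepare, z, c + (l.countP (fun y => y ≠ z) : ZMod (2 ^ a)), N, q, v₀, v₁⟩, ψ) := by
  induction l generalizing c with
  | nil => simp [StreamMachine.scan]
  | cons x l ih =>
    rw [StreamMachine.scan_cons, ← cast_countP_cons, ← ih]
    exact congrArg _ (Prod.ext rfl (one_mulVec' ψ))

theorem scan_finish (l : List (Fin n)) (z c N q v₀ v₁ ψ) :
    (machine n m a b d k w).scan l (⟨.finish, z, c, N, q, v₀, v₁⟩, ψ) =
      (⟨.finish, z, c + (l.countP (fun y => y ≠ z) : ZMod (2 ^ a)), N, q, v₀, v₁⟩, ψ) := by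
  induction l generalizing c with
  | nil => simp [StreamMachine.scan]
  | cons x l ih =>
    rw [StreamMachine.scan_cons, ← cast_countP_cons, ← ih]
    exact congrArg _ (Prod.ext rfl (one_mulVec' ψ))

theorem scan_vote (l : List (Fin n)) (p : Fin n × ZMod (2 ^ a)) (N q v₀ v₁ ψ) :
    (machine n m a b d k w).scan l (⟨.vote, p.1, p.2, N, q, v₀, v₁⟩, ψ) =
      (⟨.vote, (l.foldl (storedMajorityStep id) p).1, (l.foldl (storedMajorityStep id) p).2,
        N, q, v₀, v₁⟩, ψ) := by
  induction l generalizing p with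
  | nil => simp [StreamMachine.scan]
  | cons x l ih =>
    rw [StreamMachine.scan_cons, List.foldl_cons, ← ih]
    exact congrArg _ (Prod.ext rfl (one_mulVec' ψ))

theorem loadStep_add_loadIncr (e : Fin n → ZMod (2 ^ b)) (z x : Fin n) (l : List (Fin n))
    (c : ZMod (2 ^ a)) :
    (if x = z then 0 else Pi.single c (e x)) + loadIncr e z l (if x = z then c else c + 1) =
      loadIncr e z (x :: l) c := by
  simp only [loadIncr]
  split_ifs <;> simp

theorem scan_load (l : List (Fin n)) (t z c N q v₀ v₁) (v : ZMod (2 ^ d) → WorkReg a b → ℂ) :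
    (machine n m a b d k w).scan l (⟨.load t, z, c, N, q, v₀, v₁⟩, family v) =
      (⟨.load t, z, c + (l.countP (fun y => y ≠ z) : ZMod (2 ^ a)), N, q, v₀, v₁⟩,
        family fun y => (loadGate (loadIncr (symCode b) z l c)).1 *ᵥ v y) := by
  induction l generalizing c v with
  | nil => simp [StreamMachine.scan, loadIncr, loadGate_zero_mulVec]
  | cons x l ih =>
    rw [StreamMachine.scan_cons, ← cast_countP_cons, ← loadStep_add_loadIncr]
    simp only [← loadGate_mulVec_loadGate]
    rw [← ih]
    exact congrArg _ (Prod.ext rfl (blockGate_mulVec_family _ v))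

/-- The counter starts from the same value as in the loading pass, so adding the negated codes
subtracts each symbol at the index where it was added. -/
theorem scan_unload (l : List (Fin n)) (t z c N q v₀ v₁) (v : ZMod (2 ^ d) → WorkReg a b → ℂ) :
    (machine n m a b d k w).scan l (⟨.unload t, z, c, N, q, v₀, v₁⟩, family v) =
      (⟨.unload t, z, c + (l.countP (fun y => y ≠ z) : ZMod (2 ^ a)), N, q, v₀, v₁⟩,
        family fun y => (loadGate (-loadIncr (symCode b) z l c)).1 *ᵥ v y) := by
  simp only [← loadIncr_neg]
  induction l generalizing c v with
  | nil => simp [StreamMachine.scan, loadIncr, loadGate_zero_mulVec]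
  | cons x l ih =>
    rw [StreamMachine.scan_cons, ← cast_countP_cons, ← loadStep_add_loadIncr]
    simp only [← loadGate_mulVec_loadGate]
    rw [← ih]
    exact congrArg _ (Prod.ext rfl (blockGate_mulVec_family _ v))

theorem scan_count (l : List (Fin n)) (t z c N q v₀ v₁) (v : ZMod (2 ^ d) → WorkReg a b → ℂ) :
    (machine n m a b d k w).scan l (⟨.count t, z, c, N, q, v₀, v₁⟩, family v) =
      (⟨.count t, z, c + (l.countP (fun y => y ≠ z) : ZMod (2 ^ a)), N, q, v₀, v₁⟩,
        family fun y => (countGate (countIncr (symCode b) 1 l)).1 *ᵥ v y) := by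
  induction l generalizing c v with
  | nil => simp [StreamMachine.scan, countIncr, countGate_zero_mulVec]
  | cons x l ih =>
    rw [StreamMachine.scan_cons, ← cast_countP_cons, countIncr, List.map_cons, List.sum_cons]
    simp only [← countGate_mulVec_countGate]
    refine Eq.trans ?_ (ih _ _)
    exact congrArg _ (Prod.ext rfl (blockGate_mulVec_family _ v))

theorem scan_uncount (l : List (Fin n)) (t z c N q v₀ v₁) (v : ZMod (2 ^ d) → WorkReg a b → ℂ) :
    (machine n m a b d k w).scan l (⟨.uncount t, z, c, N, q, v₀, v₁⟩, family v) =
      (⟨.uncount t, z, c + (l.countP (fun y => y ≠ z) : ZMod (2 ^ a)), N, q, v₀, v₁⟩,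
        family fun y => (countGate (-countIncr (symCode b) 1 l)).1 *ᵥ v y) := by
  simp only [← countIncr_neg]
  induction l generalizing c v with
  | nil => simp [StreamMachine.scan, countIncr, countGate_zero_mulVec]
  | cons x l ih =>
    rw [StreamMachine.scan_cons, ← cast_countP_cons, countIncr, List.map_cons, List.sum_cons]
    simp only [← countGate_mulVec_countGate]
    refine Eq.trans ?_ (ih _ _)
    exact congrArg _ (Prod.ext rfl (blockGate_mulVec_family _ v))

/-- The data-dependent reflection for the stream `l`. -/
noncomputable def streamQuery (m a b : ℕ) (z : Fin n) (l : List (Fin n)) :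
    Matrix.unitaryGroup (WorkReg a b) ℂ :=
  queryGate (loadIncr (symCode b) z l 0) (countIncr (symCode b) 1 l) (angle m)

theorem clockGate_mulVec_family (t : ℕ) (U : Matrix.unitaryGroup (WorkReg a b) ℂ)
    (v : ZMod (2 ^ d) → WorkReg a b → ℂ) :
    (clockGate t U).1 *ᵥ family v = family fun y => if t < y.val then U.1 *ᵥ v y else v y := by
  rw [clockGate, blockGate_mulVec_family]
  congr 1
  funext y
  split_ifs
  · rfl
  · exact one_mulVec' _

variable (l : List (Fin n)) (T : Set ℝ) (τ : ℕ)

/-- Four passes carry out one controlled iteration. -/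
theorem weight_iteration (t z N q v₀ v₁) (v : ZMod (2 ^ d) → WorkReg a b → ℂ) :
    (machine n m a b d k w).weight l T (τ + 4) ⟨.load t, z, 0, N, q, v₀, v₁⟩ (family v) =
      (machine n m a b d k w).weight l T τ ⟨nextPhase (.unload t), z, 0, N, q, v₀, v₁⟩
        (family fun y => if t.val < y.val then
          (startReflection b N).1 *ᵥ ((streamQuery m a b z l).1 *ᵥ v y) else v y) := by
  rw [StreamMachine.weight_succ_of_not_measures _ (scan_load l t z 0 N q v₀ v₁ v) rfl]
  have e1 := one_mulVec' (family fun y : ZMod (2 ^ d) =>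
    (loadGate (loadIncr (symCode b) z l (0 : ZMod (2 ^ a)))).1 *ᵥ v y)
  refine (congrArg _ e1).trans ?_
  refine (StreamMachine.weight_succ_of_not_measures _ (scan_count l t z 0 N q v₀ v₁ _) rfl).trans ?_
  refine (congrArg _ (clockGate_mulVec_family t (flagGate b (angle m)) _)).trans ?_
  refine (StreamMachine.weight_succ_of_not_measures _ (scan_uncount l t z 0 N q v₀ v₁ _) rfl).trans ?_
  refine (congrArg _ (one_mulVec' _)).trans ?_
  refine (StreamMachine.weight_succ_of_not_measures _ (scan_unload l t z 0 N q v₀ v₁ _) rfl).trans ?_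
  refine (congrArg _ (clockGate_mulVec_family t (startReflection b N) _)).trans ?_
  refine congrArg _ (congrArg _ (funext fun y => ?_))
  split_ifs with h
  · rw [streamQuery, queryGate_mulVec]
  · exact uncompute_mulVec _ _ _

/-- The state of the work register after `i` iterations. -/
noncomputable def runEvolution (m b : ℕ) (N : ZMod (2 ^ a)) (z : Fin n) (l : List (Fin n)) :
    ℕ → WorkReg a b → ℂ :=
  evolution (startReflection b N) (streamQuery m a b z l) (startVec a b (support N))

/-- The phase before the `j`-th iteration. -/
def phaseAt (d j : ℕ) : Phase (2 ^ d) := if h : j < 2 ^ d then .load ⟨j, h⟩ else .finish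

/-- An iteration with number `j` acts on the clock value `y` only if `j < y`. Thus `min y j`
iterations have acted before it, and in the end exactly `y`, as phase estimation demands. -/
theorem weight_iterations (α : ℂ) (z N q v₀ v₁) (j i : ℕ) (hj : j + i = 2 ^ d) :
    (machine n m a b d k w).weight l T (τ + 4 * i) ⟨phaseAt d j, z, 0, N, q, v₀, v₁⟩
      (family fun y => (α * windowAmp y) • runEvolution m b N z l (min y.val j)) =
    (machine n m a b d k w).weight l T τ ⟨.finish, z, 0, N, q, v₀, v₁⟩
      (family fun y => (α * windowAmp y) • runEvolution m b N z l y.val) := by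
  induction i generalizing j with
  | zero =>
    have hj' : j = 2 ^ d := by omega
    subst hj'
    have hp : phaseAt d (2 ^ d) = .finish := by simp [phaseAt]
    rw [hp]
    congr 2
    funext y
    rw [min_eq_left y.val_lt.le]
  | succ i ih =>
    have hlt : j < 2 ^ d := by omega
    have hp : phaseAt d j = .load ⟨j, hlt⟩ := by simp [phaseAt, hlt]
    have hn : nextPhase (.unload ⟨j, hlt⟩) = phaseAt d (j + 1) := by simp [nextPhase, phaseAt]
    rw [hp, show τ + 4 * (i + 1) = τ + 4 * i + 4 by ring, weight_iteration, hn,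
      ← ih (j + 1) (by omega)]
    congr 2
    funext y
    dsimp only
    split_ifs with h
    · rw [mulVec_smul, mulVec_smul, min_eq_right h.le, min_eq_right (by omega : j + 1 ≤ y.val)]
      congr 1
      exact evolution_succ _ _ _ _
    · rw [min_eq_left (by omega : y.val ≤ j), min_eq_left (by omega : y.val ≤ j + 1)]

/-- The probability of an outcome of a run. -/
noncomputable def runProb (m b : ℕ) (N : ZMod (2 ^ a)) (z : Fin n) (l : List (Fin n))
    (q : WorkReg a b × ZMod (2 ^ d)) : ℝ :=
  phaseWeight (runEvolution m b N z l) q.1 q.2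

/-- The number of passes of a run. -/
def runLength (d : ℕ) : ℕ := 4 * 2 ^ d + 2

/-- A run produces an outcome and starts over with the updated votes. -/
theorem weight_run (hd : 1 < 2 ^ d) (α : ℂ) (z N q v₀ v₁) :
    (machine n m a b d k w).weight l T (τ + runLength d) ⟨.prepare, z, 0, N, q, v₀, v₁⟩
      (Pi.single q α) =
    ∑ q', (machine n m a b d k w).weight l T τ
      ⟨.prepare, z, 0, N, q',
        storedMajorityStep (fun y => gridCell w 0 (outcomeLog m y)) v₀ q'.2,
        storedMajorityStep (fun y => gridCell w 1 (outcomeLog m y)) v₁ q'.2⟩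
      (Pi.single q' (α * ∑ y, fourierMatrix (2 ^ d) q'.2 y *
        (windowAmp y * runEvolution m b N z l y.val q'.1))) := by
  rw [show τ + runLength d = (τ + 1 + 4 * 2 ^ d) + 1 by unfold runLength; ring]
  rw [StreamMachine.weight_succ_of_not_measures _ (scan_prepare l z 0 N q v₀ v₁ _) rfl]
  have hp : phaseAt d 0 = .load ⟨0, by positivity⟩ := by simp [phaseAt]
  have e1 : (prepareGate N q).1 *ᵥ (Pi.single q α) =
      family fun y => (α * windowAmp y) • runEvolution m b N z l (min y.val 0) := by
    have : (Pi.single q α : WorkReg a b × ZMod (2 ^ d) → ℂ) = α • Pi.single q 1 := by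
      rw [← Pi.single_smul, smul_eq_mul, mul_one]
    rw [this, mulVec_smul, prepareGate_mulVec hd]
    funext p
    simp [runState, family, runEvolution, evolution, mul_assoc]
  refine (congrArg _ e1).trans ?_
  have hit := weight_iterations (m := m) (k := k) (w := w) l T (τ + 1) α z N q v₀ v₁ 0 (2 ^ d)
    (by omega)
  rw [hp] at hit
  refine hit.trans ?_
  refine (StreamMachine.weight_succ_of_measures _ (scan_finish l z 0 N q v₀ v₁ _) rfl).trans ?_
  refine Finset.sum_congr rfl fun q' _ => ?_
  refine congrArg _ (congrArg _ ?_)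
  refine (fourierGate_mulVec_family _ q'.1 q'.2).trans ?_
  rw [Finset.mul_sum]
  refine Finset.sum_congr rfl fun y _ => ?_
  simp only [Pi.smul_apply, smul_eq_mul]
  ring

end EntropyMachine

/-! ### The output distribution and the accuracy of a single run. -/

namespace EntropyMachine

variable {n m a b d k : ℕ} {w : ℝ}

theorem storedCandidate_storeVote {α : Type*} {M : ℕ} {p q : α × ℕ} (hp : p.2 < M) (hq : q.2 < M) :
    storedCandidate (storeVote M p) (storeVote M q) = strongerCandidate p q := by
  simp only [storedCandidate, storeVote, strongerCandidate, ZMod.val_natCast_of_lt hp,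
    ZMod.val_natCast_of_lt hq]

/-- The vote on one of the two grids. -/
noncomputable def gridVote (m : ℕ) (w : ℝ) (shift : ℤ) (h : List (ZMod (2 ^ d))) :
    ZMod (2 ^ d) × ℕ :=
  majorityVote (fun y => gridCell w shift (outcomeLog m y)) 0 h

/-- The estimate that results from a list of outcomes. -/
noncomputable def estimateOf (m N : ℕ) (w : ℝ) (h : List (ZMod (2 ^ d))) : ℝ :=
  estimate m N (outcomeLog m (strongerCandidate (gridVote m w 0 h) (gridVote m w 1 h)))

/-- A run ends in a multiple of a basis state, and the next one starts from the same state whatever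
that basis state was. So the weights multiply, the runs are independent, and the votes are all that
is remembered of the past. -/
theorem weight_runs (hd : 1 < 2 ^ d) (l : List (Fin n)) (T : Set ℝ) (z : Fin n) (N : ZMod (2 ^ a))
    (j : ℕ) (h : List (WorkReg a b × ZMod (2 ^ d))) (hj : h.length + j = k) (q) (α : ℂ) :
    (machine n m a b d k w).weight l T (j * runLength d)
      ⟨.prepare, z, 0, N, q, storeVote _ (gridVote m w 0 (h.map Prod.snd)),
        storeVote _ (gridVote m w 1 (h.map Prod.snd))⟩ (Pi.single q α) =
    ‖α‖ ^ 2 * repeatProb (runProb m b N z l)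
      (fun h => estimateOf m N.val w (h.map Prod.snd) ∈ T) j h := by
  have hlt : ∀ i, (gridVote m w i (h.map Prod.snd)).2 < k + 1 := by
    intro i
    have := majorityVote_count_le (fun y => gridCell w i (outcomeLog m y)) 0 (h.map Prod.snd)
    rw [List.length_map] at this
    exact lt_of_le_of_lt this (by omega)
  induction j generalizing h q α with
  | zero =>
    rw [Nat.zero_mul]
    simp only [StreamMachine.weight, repeatProb, machine]
    rw [storedCandidate_storeVote (hlt 0) (hlt 1)]
    change ∑ x, T.indicator (fun _ => ‖(Pi.single q α : _ → ℂ) x‖ ^ 2)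
      (estimateOf m N.val w (h.map Prod.snd)) = _
    by_cases hT : estimateOf m N.val w (h.map Prod.snd) ∈ T
    · simp only [Set.indicator_of_mem hT, if_pos hT]
      rw [Finset.sum_eq_single q]
      · simp
      · intro q' _ hq'
        simp [hq']
      · simp
    · simp only [Set.indicator_of_notMem hT, if_neg hT, Finset.sum_const_zero, mul_zero]
  | succ j ih =>
    rw [Nat.succ_mul, weight_run l T _ hd, repeatProb, Finset.mul_sum]
    refine Finset.sum_congr rfl fun q' _ => ?_
    rw [storedMajorityStep_storeVote _ (hlt 0), storedMajorityStep_storeVote _ (hlt 1)]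
    have hstep : ∀ i, majorityStep (fun y => gridCell w i (outcomeLog m y))
        (gridVote m w i (h.map Prod.snd)) q'.2 = gridVote m w i ((h ++ [q']).map Prod.snd) := by
      intro i
      rw [List.map_append, List.map_singleton]
      exact (majorityVote_append_singleton _ _ _ _).symm
    rw [hstep, hstep, ih (h ++ [q']) (by simp; omega), norm_mul, mul_pow, runProb, phaseWeight,
      mul_assoc]
    intro i
    have := majorityVote_count_le (fun y => gridCell w i (outcomeLog m y)) 0
      ((h ++ [q']).map Prod.snd)
    rw [List.length_map, List.length_append, List.length_singleton] at this
    exact lt_of_le_of_lt this (by omega)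

/-- The initial memory. -/
def initial (z₀ : Fin n) (q₀ : WorkReg a b × ZMod (2 ^ d)) : Memory n a b d k :=
  ⟨.vote, z₀, 0, 0, q₀, storeVote _ (0, 0), storeVote _ (0, 0)⟩

/-- The output distribution of the estimator. -/
theorem weight_initial (hd : 1 < 2 ^ d) (l : List (Fin n)) (hl : l.length < 2 ^ a) (T : Set ℝ)
    (z₀ z : Fin n) (hz : z = (majorityVote id z₀ l).1) (q₀) :
    (machine n m a b d k w).weight l T (k * runLength d + 2) (initial z₀ q₀) (Pi.single q₀ 1) =
      repeatProb (runProb m b (l.countP (fun x => x ≠ z) : ZMod (2 ^ a)) z l)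
        (fun h : List (WorkReg a b × ZMod (2 ^ d)) =>
          estimateOf m (l.countP fun x => x ≠ z) w (h.map Prod.snd) ∈ T) k [] := by
  have hscan := scan_vote (m := m) (k := k) (w := w) l (storeVote (2 ^ a) (z₀, 0)) 0 q₀
    (storeVote _ (0, 0)) (storeVote _ (0, 0)) (Pi.single q₀ 1)
  rw [foldl_storedMajorityStep id z₀ l hl] at hscan
  have hinit : (initial z₀ q₀ : Memory n a b d k) = ⟨.vote, (storeVote (2 ^ a) (z₀, 0)).1,
      (storeVote (2 ^ a) (z₀, 0)).2, 0, q₀, storeVote _ (0, 0), storeVote _ (0, 0)⟩ := by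
    simp [initial, storeVote]
  rw [hinit, StreamMachine.weight_succ_of_not_measures _ hscan rfl]
  refine (congrArg _ (one_mulVec' _)).trans ?_
  refine (StreamMachine.weight_succ_of_not_measures _ (scan_tally l _ 0 0 q₀ _ _ _) rfl).trans ?_
  refine (congrArg _ (one_mulVec' _)).trans ?_
  have hz' : (storeVote (2 ^ a) (majorityVote id z₀ l)).1 = z := hz.symm
  have hval : (l.countP (fun x => x ≠ z) : ZMod (2 ^ a)).val = l.countP fun x => x ≠ z :=
    ZMod.val_natCast_of_lt (lt_of_le_of_lt List.countP_le_length hl)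
  have key := weight_runs (m := m) (k := k) (w := w) hd l T z
    (l.countP (fun x => x ≠ z) : ZMod (2 ^ a)) k ([] : List (WorkReg a b × ZMod (2 ^ d)))
    (by simp) q₀ 1
  rw [hval] at key
  rw [hz', zero_add]
  refine key.trans ?_
  simp

theorem runProb_nonneg (N : ZMod (2 ^ a)) (z : Fin n) (l : List (Fin n))
    (q : WorkReg a b × ZMod (2 ^ d)) : 0 ≤ runProb m b N z l q := sq_nonneg _

theorem sum_runProb (hd : 1 < 2 ^ d) (N : ZMod (2 ^ a)) (z : Fin n) (l : List (Fin n)) :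
    ∑ q : WorkReg a b × ZMod (2 ^ d), runProb m b N z l q = 1 := by
  rw [Fintype.sum_prod_type]
  exact sum_phaseWeight hd _ fun i => evolution_norm _ _ (startVec_norm (support_pos N) (support_le N)) i

/-- The number of elements other than `z`. -/
def otherCount (z : Fin n) (l : List (Fin n)) : ℕ := l.countP fun x => x ≠ z

/-- The mean information content of the elements other than `z`. -/
noncomputable def meanInfo (z : Fin n) (l : List (Fin n)) : ℝ :=
  ((l.filter fun x => x ≠ z).map fun x =>
    Real.logb 2 ((l.length : ℝ) / l.count x)).sum / otherCount z l

/-- The lower bound is the gain from splitting off `z`: the other symbols fill at most half of the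
stream each. The upper bound holds since a symbol that occurs does so at least once. -/
theorem info_bounds {z : Fin n} {l : List (Fin n)}
    (hmaj : ∀ x, x ≠ z → 2 * l.count x ≤ l.length) {x : Fin n} (hx : x ∈ l.filter fun x => x ≠ z) :
    1 ≤ Real.logb 2 ((l.length : ℝ) / l.count x) ∧
      Real.logb 2 ((l.length : ℝ) / l.count x) ≤ Real.logb 2 l.length := by
  rw [List.mem_filter] at hx
  have h1 : (1 : ℝ) ≤ l.count x := by exact_mod_cast List.one_le_count_iff.2 hx.1
  have h2 : 2 * (l.count x : ℝ) ≤ l.length := by exact_mod_cast hmaj x (by simpa using hx.2)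
  have hpos : 0 < (l.length : ℝ) / l.count x := div_pos (by linarith) (by linarith)
  constructor
  · rw [Real.le_logb_iff_rpow_le (by norm_num) hpos, Real.rpow_one,
      le_div_iff₀ (by linarith)]
    exact h2
  · refine Real.logb_le_logb_of_le (by norm_num) hpos ?_
    exact div_le_self (by positivity) h1

theorem otherCount_eq_length (z : Fin n) (l : List (Fin n)) :
    otherCount z l = (l.filter fun x => x ≠ z).length := List.countP_eq_length_filter

theorem meanInfo_bounds {z : Fin n} {l : List (Fin n)}
    (hmaj : ∀ x, x ≠ z → 2 * l.count x ≤ l.length) (hN : 0 < otherCount z l) :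
    1 ≤ meanInfo z l ∧ meanInfo z l ≤ Real.logb 2 l.length := by
  have hN' : (0 : ℝ) < otherCount z l := by exact_mod_cast hN
  unfold meanInfo
  rw [le_div_iff₀ hN', div_le_iff₀ hN', one_mul]
  constructor
  · have := List.card_nsmul_le_sum ((l.filter fun x => x ≠ z).map fun x =>
      Real.logb 2 ((l.length : ℝ) / l.count x)) 1 (by
        intro y hy
        obtain ⟨x, hx, rfl⟩ := List.mem_map.1 hy
        exact (info_bounds hmaj hx).1)
    rw [List.length_map, ← otherCount_eq_length] at this
    simpa using this
  · have := List.sum_le_card_nsmul ((l.filter fun x => x ≠ z).map fun x =>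
      Real.logb 2 ((l.length : ℝ) / l.count x)) (Real.logb 2 l.length) (by
        intro y hy
        obtain ⟨x, hx, rfl⟩ := List.mem_map.1 hy
        exact (info_bounds hmaj hx).2)
    rw [List.length_map, ← otherCount_eq_length] at this
    simpa [mul_comm] using this

theorem list_sum_map_one_sub_mul {α : Type*} (f : α → ℝ) (c : ℝ) (l : List α) :
    (l.map fun x => 1 - c * f x).sum = l.length - c * (l.map f).sum := by
  induction l with
  | nil => simp
  | cons x l ih =>
    simp only [List.map_cons, List.sum_cons, ih, List.length_cons]
    push_cast
    ring

/-- The expectation of the query reflection encodes the mean information content. -/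
theorem streamQuery_expectation {z : Fin n} {l : List (Fin n)} (hm : l.length = m)
    (hm2 : 1 < m) (hma : m < 2 ^ a) (hnb : n ≤ 2 ^ b)
    (hmaj : ∀ x, x ≠ z → 2 * l.count x ≤ l.length) (hN : 0 < otherCount z l) :
    ((streamQuery m a b z l).1 *ᵥ startVec a b (otherCount z l)) ⬝ᵥ
      star (startVec a b (otherCount z l)) =
      ((1 - 2 * (meanInfo z l / Real.logb 2 m) : ℝ) : ℂ) := by
  have hNle : otherCount z l ≤ m := by rw [← hm]; exact List.countP_le_length
  have hL : 0 < Real.logb 2 m := Real.logb_pos (by norm_num) (by exact_mod_cast hm2)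
  rw [streamQuery, queryGate_expectation (hNle.trans hma.le)]
  congr 1
  have hsum := sum_loadIncr (A := 2 ^ a) (symCode b) z l 0
    (by rw [zero_add]; exact hNle.trans hma.le)
    fun i => Real.cos (angle m (countIncr (symCode b) (1 : ZMod (2 ^ a)) l i))
  simp only [zero_add, Nat.cast_zero] at hsum
  rw [otherCount] at *
  rw [hsum]
  have hcos : ∀ x ∈ l.filter fun x => x ≠ z,
      Real.cos (angle m (countIncr (symCode b) (1 : ZMod (2 ^ a)) l (symCode b x))) =
        1 - 2 / Real.logb 2 m * Real.logb 2 ((l.length : ℝ) / l.count x) := by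
    intro x hx
    obtain ⟨h1, h2⟩ := info_bounds hmaj hx
    have hlt : l.count x < 2 ^ a := lt_of_le_of_lt (List.count_le_length.trans hm.le) hma
    rw [countIncr_apply (symCode_injective hnb), angle, ZMod.val_natCast_of_lt hlt]
    rw [hm] at h1 h2 ⊢
    have h3 : Real.logb 2 ((m : ℝ) / l.count x) / Real.logb 2 m ≤ 1 := (div_le_one hL).2 h2
    have h4 : 0 ≤ Real.logb 2 ((m : ℝ) / l.count x) / Real.logb 2 m := by positivity
    rw [Real.cos_arccos (by linarith) (by linarith)]
    ring
  rw [List.map_congr_left hcos, list_sum_map_one_sub_mul]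
  have hN' : ((l.countP fun x => x ≠ z : ℕ) : ℝ) ≠ 0 := by exact_mod_cast hN.ne'
  rw [meanInfo, otherCount, ← List.countP_eq_length_filter]
  field_simp

/-- A single run is accurate with high probability. -/
theorem sum_bad_runProb_le (hd : 2 < 2 ^ d) {z : Fin n} {l : List (Fin n)} (hm : l.length = m)
    (hm2 : 1 < m) (hma : m < 2 ^ a) (hnb : n ≤ 2 ^ b)
    (hmaj : ∀ x, x ≠ z → 2 * l.count x ≤ l.length) (hN : 0 < otherCount z l)
    {η : ℝ} (hη : 0 < η) (hη2 : η ≤ 1 / 2)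
    (hD : (2 * Real.pi / (2 ^ d : ℕ)) ^ 2 ≤ η ^ 2 / (128 * Real.logb 2 m))
    (good : WorkReg a b × ZMod (2 ^ d) → Prop) [DecidablePred good]
    (hgood : ∀ q, |outcomeLog m q.2 - Real.log (meanInfo z l)| ≤ 2 * η → good q) :
    ∑ q with ¬ good q, runProb m b (otherCount z l : ZMod (2 ^ a)) z l q ≤ 1 / 64 := by
  obtain ⟨hA1, hA2⟩ := meanInfo_bounds hmaj hN
  rw [hm] at hA2
  set L := Real.logb 2 m with hLdef
  have hL : 0 < L := Real.logb_pos (by norm_num) (by exact_mod_cast hm2)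
  set p := meanInfo z l / L with hp
  set μ : ℝ := 1 - 2 * p with hμ
  have hp1 : p ≤ 1 := (div_le_one hL).2 hA2
  have hp0 : 0 < p := div_pos (by linarith) hL
  have hpL : 1 / L ≤ p := by rw [hp]; gcongr
  have hNlt : otherCount z l < 2 ^ a :=
    lt_of_le_of_lt (by rw [← hm]; exact List.countP_le_length) hma
  have hsupp : support (otherCount z l : ZMod (2 ^ a)) = otherCount z l := by
    rw [support, ZMod.val_natCast_of_lt hNlt]; omega
  have hexp : ((streamQuery m a b z l).1 *ᵥ
      startVec a b (support (otherCount z l : ZMod (2 ^ a)))) ⬝ᵥ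
      star (startVec a b (support (otherCount z l : ZMod (2 ^ a)))) = (μ : ℂ) := by
    rw [hsupp]
    exact streamQuery_expectation hm hm2 hma hnb hmaj hN
  have hs := startVec_norm (b := b) (support_pos (otherCount z l : ZMod (2 ^ a)))
    (support_le (otherCount z l : ZMod (2 ^ a)))
  have hvar := sum_phaseWeight_mul_sq_le hd
    (runEvolution m b (otherCount z l : ZMod (2 ^ a)) z l)
    (evolution_norm _ _ hs) (μ := μ) (abs_le.2 ⟨by linarith, by linarith⟩)
    (evolution_corr_one _ hs hexp) (evolution_corr_two _ (queryGate_mul_self _ _ _) hs hexp)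
  rw [← Fintype.sum_prod_type (f := fun q : WorkReg a b × ZMod (2 ^ d) =>
    phaseWeight (runEvolution m b (otherCount z l : ZMod (2 ^ a)) z l) q.1 q.2 *
      ((ZMod.stdAddChar q.2 : ℂ).re - μ) ^ 2)] at hvar
  have hρ0 : 0 ≤ rootStep (2 ^ d) := norm_nonneg _
  -- The clock size is chosen for the worst case `p = 1 / L`, so its precision is sufficient for
  -- every larger `p`.
  have hρ : rootStep (2 ^ d) ^ 2 ≤ η ^ 2 * p / 128 := by
    calc rootStep (2 ^ d) ^ 2 ≤ (2 * Real.pi / (2 ^ d : ℕ)) ^ 2 :=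
          pow_le_pow_left₀ hρ0 rootStep_le 2
      _ ≤ η ^ 2 / (128 * L) := hD
      _ = η ^ 2 * (1 / L) / 128 := by field_simp
      _ ≤ _ := by gcongr
  -- Contrapositive: an error below `2 * η * p` in the cosine is a relative error of at most `η` in
  -- `p`, hence at most `2 * η` in its logarithm, because `η ≤ 1 / 2`.
  have hbad : ∀ q : WorkReg a b × ZMod (2 ^ d), ¬ good q →
      (2 * η * p) ^ 2 ≤ ((ZMod.stdAddChar q.2 : ℂ).re - μ) ^ 2 := by
    intro q hq
    by_contra! hlt
    apply hq
    apply hgood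
    have habs : |(ZMod.stdAddChar q.2 : ℂ).re - μ| < 2 * η * p :=
      abs_lt_of_sq_lt_sq hlt (by positivity)
    rw [abs_lt] at habs
    set t := (1 - (ZMod.stdAddChar q.2 : ℂ).re) / 2 with ht
    have h1 : (1 - η) * p ≤ t := by rw [ht]; linarith [habs.2]
    have h2 : t ≤ (1 + η) * p := by rw [ht]; linarith [habs.1]
    have ht0 : 0 < t := lt_of_lt_of_le (mul_pos (by linarith) hp0) h1
    have hlog : outcomeLog m q.2 - Real.log (meanInfo z l) = Real.log (t / p) := by
      rw [outcomeLog, Real.log_mul ht0.ne' hL.ne', Real.log_div ht0.ne' hp0.ne', hp,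
        Real.log_div (one_pos.trans_le hA1).ne' hL.ne']
      ring
    rw [hlog, abs_le]
    have hr1 : 1 - η ≤ t / p := (le_div_iff₀ hp0).2 h1
    have hr2 : t / p ≤ 1 + η := (div_le_iff₀ hp0).2 h2
    have hr0 : 0 < t / p := div_pos ht0 hp0
    constructor
    · have h3 := Real.one_sub_inv_le_log_of_pos hr0
      have h4 : (t / p)⁻¹ ≤ 1 + 2 * η := by
        rw [inv_le_iff_one_le_mul₀ hr0]
        nlinarith
      linarith
    · have := Real.log_le_sub_one_of_pos hr0
      linarith
  -- Chebyshev's inequality, with the variance bound of phase estimation.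
  have hcheb : (∑ q with ¬ good q, runProb m b (otherCount z l : ZMod (2 ^ a)) z l q) *
      (2 * η * p) ^ 2 ≤ rootStep (2 ^ d) ^ 2 * (1 - μ ^ 2) + rootStep (2 ^ d) ^ 4 / 2 := by
    refine le_trans ?_ hvar
    rw [Finset.sum_mul]
    refine (Finset.sum_le_sum fun q hq => ?_).trans
      (Finset.sum_le_sum_of_subset_of_nonneg (Finset.filter_subset _ _) fun q _ _ => ?_)
    · exact mul_le_mul_of_nonneg_left (hbad q (Finset.mem_filter.1 hq).2) (runProb_nonneg _ _ _ _)
    · exact mul_nonneg (runProb_nonneg (m := m) (otherCount z l : ZMod (2 ^ a)) z l q) (sq_nonneg _)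
  have hμ2 : 1 - μ ^ 2 ≤ 4 * p := by rw [hμ]; nlinarith
  have hμ3 : 0 ≤ 1 - μ ^ 2 := by rw [hμ]; nlinarith
  have hb1 : rootStep (2 ^ d) ^ 2 * (1 - μ ^ 2) ≤ η ^ 2 * p / 128 * (4 * p) :=
    mul_le_mul hρ hμ2 hμ3 (by positivity)
  have hb2 : rootStep (2 ^ d) ^ 4 ≤ (η ^ 2 * p / 128) ^ 2 := by
    rw [show rootStep (2 ^ d) ^ 4 = (rootStep (2 ^ d) ^ 2) ^ 2 by ring]
    exact pow_le_pow_left₀ (sq_nonneg _) hρ 2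
  have hpos : 0 < (2 * η * p) ^ 2 := by positivity
  -- The main term is at most `η ^ 2 * p ^ 2 / 32`, half of the permitted `η ^ 2 * p ^ 2 / 16`; the
  -- fourth-order term fits into the remainder.
  have hfin : (∑ q with ¬ good q, runProb m b (otherCount z l : ZMod (2 ^ a)) z l q) *
      (2 * η * p) ^ 2 ≤ 1 / 64 * (2 * η * p) ^ 2 := by
    have hη4 : η ^ 2 ≤ 1 := by nlinarith
    have : (η ^ 2 * p / 128) ^ 2 ≤ 1 / 64 * (η * p) ^ 2 := by
      have : η ^ 2 * (η * p) ^ 2 ≤ (η * p) ^ 2 := by nlinarith [sq_nonneg (η * p)]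
      nlinarith
    nlinarith
  exact le_of_mul_le_mul_right hfin hpos

end EntropyMachine

/-! ### Splitting off one symbol from the entropy. -/

section Entropy

variable {n m : ℕ}

theorem card_filter_eq_count (x : Fin m → Fin n) (i : Fin n) :
    (Finset.univ.filter fun j => x j = i).card = (List.ofFn x).count i := by
  rw [List.ofFn_eq_map, List.count, List.countP_map, List.countP_eq_length_filter,
    ← List.toFinset_card_of_nodup ((List.nodup_finRange m).filter _)]
  congr 1
  ext j
  simp

theorem empiricalProb_eq (x : Fin m → Fin n) (i : Fin n) :
    empiricalProb x i = ((List.ofFn x).count i : ℝ) / m := by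
  rw [empiricalProb, card_filter_eq_count]

theorem sum_filter_map_eq (z : Fin n) (f : Fin n → ℝ) (l : List (Fin n)) :
    ((l.filter fun x => x ≠ z).map f).sum = ∑ i ∈ Finset.univ.erase z, (l.count i : ℝ) * f i := by
  induction l with
  | nil => simp
  | cons x l ih =>
    have hsplit : ∑ i ∈ Finset.univ.erase z, ((x :: l).count i : ℝ) * f i =
        ∑ i ∈ Finset.univ.erase z, (l.count i : ℝ) * f i +
          ∑ i ∈ Finset.univ.erase z, if x = i then f i else 0 := by
      rw [← Finset.sum_add_distrib]
      refine Finset.sum_congr rfl fun i _ => ?_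
      rw [List.count_cons]
      by_cases h : x = i
      · simp [h]; ring
      · simp [h]
    rw [hsplit, ← ih, Finset.sum_ite_eq]
    by_cases h : x = z
    · simp [h]
    · rw [List.filter_cons_of_pos (by simpa using h)]
      simp [h, add_comm]

theorem length_eq_count_add (z : Fin n) (l : List (Fin n)) :
    l.length = l.count z + EntropyMachine.otherCount z l := by
  have := List.length_eq_countP_add_countP (fun x => x == z) (l := l)
  rw [this, List.count, EntropyMachine.otherCount]
  congr 2
  ext x
  simp

theorem neg_mul_logb_eq (c : ℕ) :
    -((c : ℝ) / m * Real.logb 2 ((c : ℝ) / m)) = c / m * Real.logb 2 ((m : ℝ) / c) := by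
  rw [← inv_div (m : ℝ) c, Real.logb_inv]
  ring

/-- The entropy splits into the contribution of one symbol and the mean information content of the
others. -/
theorem streamEntropy_eq (hm : 0 < m) (x : Fin m → Fin n) (z : Fin n) :
    streamEntropy x = -(((m - EntropyMachine.otherCount z (List.ofFn x) : ℝ) / m) *
        Real.logb 2 ((m - EntropyMachine.otherCount z (List.ofFn x) : ℝ) / m)) +
      EntropyMachine.otherCount z (List.ofFn x) / m *
        EntropyMachine.meanInfo z (List.ofFn x) := by
  have hlen : (List.ofFn x).length = m := List.length_ofFn
  have hz : ((List.ofFn x).count z : ℝ) = m - EntropyMachine.otherCount z (List.ofFn x) := by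
    have := length_eq_count_add z (List.ofFn x)
    rw [hlen] at this
    rw [eq_sub_iff_add_eq]
    exact_mod_cast this.symm
  rw [streamEntropy, ← Finset.add_sum_erase _ _ (Finset.mem_univ z), empiricalProb_eq, hz]
  congr 1
  have hm' : (m : ℝ) ≠ 0 := by exact_mod_cast hm.ne'
  have hsum : EntropyMachine.otherCount z (List.ofFn x) * EntropyMachine.meanInfo z (List.ofFn x) =
      ∑ i ∈ Finset.univ.erase z, ((List.ofFn x).count i : ℝ) *
        Real.logb 2 ((m : ℝ) / (List.ofFn x).count i) := by
    rw [← sum_filter_map_eq, EntropyMachine.meanInfo, hlen]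
    by_cases h0 : EntropyMachine.otherCount z (List.ofFn x) = 0
    · rw [h0]
      rw [EntropyMachine.otherCount_eq_length, List.length_eq_zero_iff] at h0
      rw [h0]
      simp
    · have : (EntropyMachine.otherCount z (List.ofFn x) : ℝ) ≠ 0 := by exact_mod_cast h0
      field_simp
  rw [div_mul_eq_mul_div, hsum, Finset.sum_div]
  refine Finset.sum_congr rfl fun i _ => ?_
  rw [empiricalProb_eq, neg_mul_logb_eq]
  ring

/-- Nothing is claimed about the frequency of the survivor; only the others have to be at most half
of the stream. -/
theorem majority_bound (z₀ : Fin n) (l : List (Fin n)) (y : Fin n)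
    (hy : y ≠ (majorityVote id z₀ l).1) : 2 * l.count y ≤ l.length := by
  have h := (majorityVote_invariant id z₀ l).2.2 y hy
  have : l.count y = l.countP (fun x => decide (id x = y)) := by
    rw [List.count]; congr
  omega

theorem neg_mul_logb_nonneg {N : ℕ} (hN : N ≤ m) :
    0 ≤ -(((m - N : ℝ) / m) * Real.logb 2 ((m - N : ℝ) / m)) := by
  have h : (N : ℝ) ≤ m := by exact_mod_cast hN
  have h0 : (0 : ℝ) ≤ (m - N : ℝ) / m := div_nonneg (by linarith) (by positivity)
  have h1 : (m - N : ℝ) / m ≤ 1 := div_le_one_of_le₀ (by linarith [N.cast_nonneg (α := ℝ)]) (by positivity)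
  have := Real.logb_nonpos (b := 2) (by norm_num) h0 h1
  nlinarith

/-- Either all elements of the stream coincide, or the entropy is not too small. -/
theorem streamEntropy_eq_zero_or (hm : 0 < m) (hn : 0 < n) (x : Fin m → Fin n) :
    streamEntropy x = 0 ∨ 1 / (m : ℝ) ≤ streamEntropy x := by
  set z := (majorityVote id ⟨0, hn⟩ (List.ofFn x)).1 with hz
  have hlen : (List.ofFn x).length = m := List.length_ofFn
  have hm' : (0 : ℝ) < m := by exact_mod_cast hm
  rw [streamEntropy_eq hm x z]
  rcases Nat.eq_zero_or_pos (EntropyMachine.otherCount z (List.ofFn x)) with h0 | h0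
  · left
    rw [h0]
    simp [hm'.ne']
  · right
    have h1 := (EntropyMachine.meanInfo_bounds
      (fun y hy => majority_bound ⟨0, hn⟩ (List.ofFn x) y hy) h0).1
    have hN : EntropyMachine.otherCount z (List.ofFn x) ≤ m := by
      have := length_eq_count_add z (List.ofFn x); omega
    have h2 := neg_mul_logb_nonneg hN
    have h3 : (1 : ℝ) ≤ EntropyMachine.otherCount z (List.ofFn x) := by exact_mod_cast h0
    have h4 : 1 / (m : ℝ) ≤ EntropyMachine.otherCount z (List.ofFn x) / m *
        EntropyMachine.meanInfo z (List.ofFn x) := by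
      rw [div_mul_eq_mul_div]
      gcongr
      nlinarith
    linarith

theorem exp_mem_Icc {ε A t : ℝ} (hε : 0 < ε) (hε1 : ε < 1) (hA : 0 < A)
    (ht : |t - Real.log A| ≤ ε / 2) : (1 - ε) * A ≤ Real.exp t ∧ Real.exp t ≤ (1 + ε) * A := by
  have he : Real.exp t = Real.exp (t - Real.log A) * A := by
    rw [Real.exp_sub, Real.exp_log hA]; field_simp
  rw [abs_le] at ht
  rw [he]
  constructor
  · refine mul_le_mul_of_nonneg_right ?_ hA.le
    linarith [Real.add_one_le_exp (t - Real.log A)]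
  · refine mul_le_mul_of_nonneg_right ?_ hA.le
    have h1 : Real.exp (t - Real.log A) ≤ Real.exp (ε / 2) := Real.exp_le_exp.2 ht.2
    have h2 := Real.exp_bound_div_one_sub_of_interval (x := ε / 2) (by linarith) (by linarith)
    have h3 : 1 / (1 - ε / 2) ≤ 1 + ε := by
      rw [div_le_iff₀ (by linarith)]
      nlinarith
    linarith

end Entropy

/-! ### Accuracy of the estimator after all repetitions. -/

namespace EntropyMachine

variable {n m a b d k : ℕ}

open scoped Classical in
/-- The estimator is accurate with high probability. -/
theorem one_sub_le_weight (hd : 2 < 2 ^ d) (hm2 : 1 < m) (hma : m < 2 ^ a) (hnb : n ≤ 2 ^ b)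
    {ε : ℝ} (hε : 0 < ε) (hε1 : ε < 1)
    (hD : (2 * Real.pi / (2 ^ d : ℕ)) ^ 2 ≤ (ε / 20) ^ 2 / (128 * Real.logb 2 m))
    (x : Fin m → Fin n) (z₀ : Fin n) (q₀) :
    1 - 1 / 2 ^ k ≤ (machine n m a b d k (ε / 5)).weight (List.ofFn x)
      (Set.Icc ((1 - ε) * streamEntropy x) ((1 + ε) * streamEntropy x)) (k * runLength d + 2)
      (initial z₀ q₀) (Pi.single q₀ 1) := by
  have hm0 : 0 < m := by omega
  have hlen : (List.ofFn x).length = m := List.length_ofFn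
  set l := List.ofFn x with hl
  obtain ⟨z, hz⟩ : ∃ z, z = (majorityVote id z₀ l).1 := ⟨_, rfl⟩
  have hmaj : ∀ y, y ≠ z → 2 * l.count y ≤ l.length := fun y hy =>
    majority_bound z₀ l y (hz ▸ hy)
  have hNm : otherCount z l ≤ m := by
    have := length_eq_count_add z l; omega
  rw [weight_initial (by omega) l (by omega) _ z₀ z hz]
  change 1 - 1 / 2 ^ k ≤ repeatProb (runProb m b (otherCount z l : ZMod (2 ^ a)) z l)
    (fun h => estimateOf m (otherCount z l) (ε / 5) (h.map Prod.snd) ∈ _) k []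
  rw [streamEntropy_eq hm0 x z, ← hl]
  have hH0 := neg_mul_logb_nonneg hNm
  set H₀ := -(((m - otherCount z l : ℝ) / m) * Real.logb 2 ((m - otherCount z l : ℝ) / m)) with hH₀
  -- Error budget on the logarithmic scale: a good run is within `ε / 10`, half of the mesh `ε / 5`;
  -- the vote is then within `5 / 2 * (ε / 5) = ε / 2`, and exponentiating gives relative error `ε`.
  -- Adding the exact nonnegative term `H₀` does not increase it. If all elements coincide, every
  -- outcome counts as good.
  set good : WorkReg a b × ZMod (2 ^ d) → Prop := fun q => 0 < otherCount z l →
    |outcomeLog m q.2 - Real.log (meanInfo z l)| ≤ ε / 10 with hgood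
  have hbad : ∑ q with ¬ good q, runProb m b (otherCount z l : ZMod (2 ^ a)) z l q ≤ 1 / 64 := by
    rcases Nat.eq_zero_or_pos (otherCount z l) with h0 | h0
    · rw [Finset.filter_false_of_mem]
      · simp
      · intro q _ hq
        exact hq fun h => absurd h (by omega)
    · refine sum_bad_runProb_le hd hlen hm2 hma hnb hmaj h0 (η := ε / 20) (by positivity)
        (by linarith) hD good fun q hq _ => hq.trans (by linarith)
  have hG : ∀ h : List (WorkReg a b × ZMod (2 ^ d)), h.length = k →
      3 * h.countP (fun q => ¬ good q) < k →
      estimateOf m (otherCount z l) (ε / 5) (h.map Prod.snd) ∈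
        Set.Icc ((1 - ε) * (H₀ + otherCount z l / m * meanInfo z l))
          ((1 + ε) * (H₀ + otherCount z l / m * meanInfo z l)) := by
    intro h hk hc
    rcases Nat.eq_zero_or_pos (otherCount z l) with h0 | h0
    -- Without other elements the estimated part has coefficient zero, so the output is exact
    -- whatever was measured.
    · rw [estimateOf, estimate, ← hH₀]
      have : H₀ = 0 := by
        rw [hH₀, h0]
        have : (m : ℝ) ≠ 0 := by exact_mod_cast hm0.ne'
        simp [this]
      rw [h0, this]
      simp
    · have hA := (meanInfo_bounds hmaj h0).1
      have hvote := abs_sub_le_of_grid_vote (outcomeLog m) (w := ε / 5) (by positivity)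
        (Real.log (meanInfo z l)) (0 : ZMod (2 ^ d))
        (fun y => |outcomeLog m y - Real.log (meanInfo z l)| ≤ ε / 10)
        (fun y hy => hy.trans (by linarith)) (h.map Prod.snd) (by
          rw [List.countP_map, List.length_map, hk]
          convert hc using 3
          ext q
          simp [hgood, h0])
      obtain ⟨h1, h2⟩ := exp_mem_Icc (A := meanInfo z l) hε hε1 (by linarith)
        (hvote.trans (by linarith))
      have hr : (0 : ℝ) ≤ otherCount z l / m := by positivity
      rw [estimateOf, estimate, ← hH₀]
      constructor
      · have := mul_le_mul_of_nonneg_left h1 hr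
        unfold gridVote
        nlinarith
      · have := mul_le_mul_of_nonneg_left h2 hr
        unfold gridVote
        nlinarith
  have main := one_sub_le_repeatProb (runProb m b (otherCount z l : ZMod (2 ^ a)) z l) _
    (runProb_nonneg _ z l) (sum_runProb (by omega) _ z l) good hbad hG k [] (by simp)
  refine le_trans (le_of_eq ?_) main
  rw [List.countP_nil, pow_zero, mul_one, show (4 : ℝ) = 2 * 2 by norm_num, mul_pow]
  field_simp

end EntropyMachine

/-! ### The deterministic algorithm with one pass per symbol. -/

namespace ExactMachine

variable {n m G M : ℕ}

/-- The contribution to the entropy of a symbol that occurs `c` times. -/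
noncomputable def term (m c : ℕ) : ℝ := c / m * Real.logb 2 ((m : ℝ) / c)

/-- The machine which counts one symbol in each pass and sums up the rounded contributions to
the entropy. -/
noncomputable def machine (n m G M : ℕ) :
    StreamMachine n (ZMod (n + 1) × ZMod (m + 1) × ZMod M) Unit where
  update s x := (s.1, if (x.val : ZMod (n + 1)) = s.1 then s.2.1 + 1 else s.2.1, s.2.2)
  gate _ _ := 1
  endGate _ := 1
  measures _ := false
  endUpdate s := (s.1 + 1, 0, s.2.2 + (⌊G * term m s.2.1.val⌋₊ : ZMod M))
  outcomeUpdate s _ := s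
  output s := s.2.2.val / G

theorem scan_eq (l : List (Fin n)) (i c r ψ) :
    (machine n m G M).scan l ((i, c, r), ψ) =
      ((i, c + (l.countP (fun x => (x.val : ZMod (n + 1)) = i) : ZMod (m + 1)), r), ψ) := by
  induction l generalizing c with
  | nil => simp [StreamMachine.scan]
  | cons x l ih =>
    rw [StreamMachine.scan_cons]
    have hstep : ((machine n m G M).update (i, c, r) x, ((machine n m G M).gate (i, c, r) x).1 *ᵥ ψ)
        = ((i, if (x.val : ZMod (n + 1)) = i then c + 1 else c, r), ψ) :=
      Prod.ext rfl (EntropyMachine.one_mulVec' ψ)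
    rw [hstep, ih]
    rw [List.countP_cons]
    by_cases h : (x.val : ZMod (n + 1)) = i
    · simp [h]; ring
    · simp [h]

/-- The number of occurrences of the symbol with number `i`. -/
def occurrences (l : List (Fin n)) (i : ℕ) : ℕ := l.countP fun x => x.val = i

/-- The sum after the first `i` passes. -/
noncomputable def partialSum (m G : ℕ) (l : List (Fin n)) (i : ℕ) : ℕ :=
  ∑ j ∈ Finset.range i, ⌊G * term m (occurrences l j)⌋₊

theorem weight_passes (l : List (Fin n)) (hl : l.length = m) (T : Set ℝ) (t i : ℕ) (hi : i + t ≤ n)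
    (ψ : Unit → ℂ) :
    (machine n m G M).weight l T t ((i : ZMod (n + 1)), 0, (partialSum m G l i : ZMod M)) ψ =
      (machine n m G M).weight l T 0
        (((i + t : ℕ) : ZMod (n + 1)), 0, (partialSum m G l (i + t) : ZMod M)) ψ := by
  induction t generalizing i with
  | zero => rfl
  | succ t ih =>
    have hc : l.countP (fun x => (x.val : ZMod (n + 1)) = (i : ZMod (n + 1))) =
        occurrences l i := by
      refine List.countP_congr fun x _ => ?_
      simp only [decide_eq_true_eq]
      constructor
      · intro h
        have := congrArg ZMod.val h
        rwa [ZMod.val_natCast_of_lt (by omega), ZMod.val_natCast_of_lt (by omega)] at this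
      · intro h; rw [h]
    have hlt : occurrences l i < m + 1 :=
      Nat.lt_succ_of_le (hl ▸ List.countP_le_length)
    refine (StreamMachine.weight_succ_of_not_measures _ (scan_eq l _ _ _ _) rfl).trans ?_
    refine (congrArg _ (EntropyMachine.one_mulVec' _)).trans ?_
    rw [show i + (t + 1) = i + 1 + t by ring, ← ih (i + 1) (by omega)]
    refine congrFun (congrArg _ ?_) _
    simp only [machine, hc, zero_add, ZMod.val_natCast_of_lt hlt, partialSum,
      Finset.sum_range_succ]
    push_cast
    rfl

theorem term_nonneg {c : ℕ} (h : c ≤ m) : 0 ≤ term m c := by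
  rcases Nat.eq_zero_or_pos c with rfl | hc
  · simp [term]
  · refine mul_nonneg (by positivity) (Real.logb_nonneg (by norm_num) ?_)
    rw [le_div_iff₀ (by exact_mod_cast hc), one_mul]
    exact_mod_cast h

theorem term_le {c : ℕ} (hm : 0 < m) (h : c ≤ m) : term m c ≤ m := by
  have hm' : (1 : ℝ) ≤ m := by exact_mod_cast hm
  rcases Nat.eq_zero_or_pos c with rfl | hc
  · simp [term]
  · have hc' : (1 : ℝ) ≤ c := by exact_mod_cast hc
    have h1 : (c : ℝ) / m ≤ 1 := div_le_one_of_le₀ (by exact_mod_cast h) (by positivity)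
    have h2 : Real.logb 2 ((m : ℝ) / c) ≤ m := by
      rw [Real.logb_le_iff_le_rpow (by norm_num) (by positivity), Real.rpow_natCast]
      calc (m : ℝ) / c ≤ m := div_le_self (by positivity) hc'
        _ ≤ 2 ^ m := by exact_mod_cast Nat.lt_two_pow_self.le
    have h3 : 0 ≤ Real.logb 2 ((m : ℝ) / c) := by
      refine Real.logb_nonneg (by norm_num) ?_
      rw [le_div_iff₀ (by linarith), one_mul]
      exact_mod_cast h
    unfold term
    nlinarith [show (0 : ℝ) ≤ (c : ℝ) / m by positivity]

theorem occurrences_le (l : List (Fin n)) (hl : l.length = m) (i : ℕ) : occurrences l i ≤ m :=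
  hl ▸ List.countP_le_length

theorem partialSum_le (hm : 0 < m) (l : List (Fin n)) (hl : l.length = m) :
    partialSum m G l n ≤ n * (G * m) := by
  calc partialSum m G l n ≤ ∑ _j ∈ Finset.range n, G * m := by
        refine Finset.sum_le_sum fun j _ => ?_
        refine Nat.floor_le_of_le ?_
        push_cast
        exact mul_le_mul_of_nonneg_left (term_le hm (occurrences_le l hl j)) (by positivity)
    _ = _ := by simp

theorem streamEntropy_eq_sum (x : Fin m → Fin n) :
    streamEntropy x = ∑ j ∈ Finset.range n, term m (occurrences (List.ofFn x) j) := by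
  rw [streamEntropy, ← Fin.sum_univ_eq_sum_range fun j => term m (occurrences (List.ofFn x) j)]
  refine Finset.sum_congr rfl fun i _ => ?_
  rw [empiricalProb_eq, neg_mul_logb_eq]
  have : (List.ofFn x).count i = occurrences (List.ofFn x) i := by
    rw [List.count, occurrences]
    refine List.countP_congr fun y _ => ?_
    simp [Fin.ext_iff]
  rw [this, term]

/-- The machine outputs an approximation of the entropy with certainty. -/
theorem weight_eq_one (hm : 0 < m) (hn : 0 < n) {ε : ℝ} (hε : 0 < ε)
    (hG : (n * m : ℝ) / ε ≤ G) (hM : n * (G * m) < M) (x : Fin m → Fin n) :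
    (machine n m G M).weight (List.ofFn x)
      (Set.Icc ((1 - ε) * streamEntropy x) ((1 + ε) * streamEntropy x)) n (0, 0, 0)
      (Pi.single () 1) = 1 := by
  have hlen : (List.ofFn x).length = m := List.length_ofFn
  have hm' : (0 : ℝ) < m := by exact_mod_cast hm
  have hn' : (0 : ℝ) < n := by exact_mod_cast hn
  have hG0 : (0 : ℝ) < G := lt_of_lt_of_le (by positivity) hG
  have h := weight_passes (G := G) (M := M) (List.ofFn x) hlen
    (Set.Icc ((1 - ε) * streamEntropy x) ((1 + ε) * streamEntropy x)) n 0 (by omega)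
    (Pi.single () 1)
  have h0 : partialSum m G (List.ofFn x) 0 = 0 := rfl
  rw [h0, Nat.cast_zero, Nat.cast_zero, zero_add] at h
  rw [h]
  have hval : (partialSum m G (List.ofFn x) n : ZMod M).val = partialSum m G (List.ofFn x) n :=
    ZMod.val_natCast_of_lt (lt_of_le_of_lt (partialSum_le hm _ hlen) hM)
  simp only [StreamMachine.weight, machine, hval]
  rw [Fintype.sum_unique, Set.indicator_of_mem]
  · simp
  · have hH := streamEntropy_eq_sum x
    have hub : (partialSum m G (List.ofFn x) n : ℝ) ≤ G * streamEntropy x := by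
      rw [hH, partialSum, Finset.mul_sum]
      push_cast
      exact Finset.sum_le_sum fun j _ => Nat.floor_le
        (mul_nonneg hG0.le (term_nonneg (occurrences_le _ hlen j)))
    -- Each of the `n` roundings loses at most 1 on the scale `G`.
    have hlb : G * streamEntropy x ≤ partialSum m G (List.ofFn x) n + n := by
      rw [hH, partialSum, Finset.mul_sum]
      push_cast
      calc _ ≤ ∑ j ∈ Finset.range n,
            ((⌊G * term m (occurrences (List.ofFn x) j)⌋₊ : ℝ) + 1) :=
            Finset.sum_le_sum fun j _ => (Nat.lt_floor_add_one _).le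
        _ = _ := by rw [Finset.sum_add_distrib]; simp
    have hH0 : 0 ≤ streamEntropy x := by
      rw [hH]
      exact Finset.sum_nonneg fun j _ => term_nonneg (occurrences_le _ hlen j)
    constructor
    · rw [le_div_iff₀ hG0]
      -- The additive error `n / G ≤ ε / m` is a relative error `ε`, because a nonzero entropy is at
      -- least `1 / m`.
      rcases streamEntropy_eq_zero_or hm hn x with h0 | h1
      · rw [h0]; simp
      · have h2 : (n : ℝ) ≤ ε * streamEntropy x * G := by
          rw [div_le_iff₀ hε] at hG
          rw [div_le_iff₀ hm'] at h1
          have h3 : (n : ℝ) * m ≤ (G * ε) * (streamEntropy x * m) :=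
            hG.trans (le_mul_of_one_le_right (by positivity) h1)
          have h4 : (n : ℝ) * m ≤ (ε * streamEntropy x * G) * m := by linarith
          exact le_of_mul_le_mul_right h4 hm'
        linarith
    · rw [div_le_iff₀ hG0]
      nlinarith [mul_nonneg (mul_nonneg hε.le hH0) hG0.le]

end ExactMachine

/-! ### Counting passes, qubits and bits, and the choice of parameters. -/

theorem exists_two_pow_bounds {x : ℕ} (hx : 0 < x) : ∃ d, x ≤ 2 ^ d ∧ 2 ^ d ≤ 2 * x := by
  refine ⟨Nat.clog 2 x, Nat.le_pow_clog (by norm_num) x, ?_⟩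
  rcases Nat.lt_or_ge 1 x with h | h
  · have h1 := Nat.pow_pred_clog_lt_self (b := 2) (by norm_num) h
    have h2 : 0 < Nat.clog 2 x := Nat.clog_pos (by norm_num) h
    obtain ⟨c, hc⟩ := Nat.exists_eq_succ_of_ne_zero h2.ne'
    rw [hc] at h1 ⊢
    rw [Nat.pred_succ] at h1
    rw [pow_succ]
    omega
  · have : x = 1 := by omega
    subst this
    simp

theorem natCast_le_logb {d : ℕ} {x : ℝ} (h : (2 : ℝ) ^ d ≤ x) : (d : ℝ) ≤ Real.logb 2 x := by
  rw [Real.le_logb_iff_rpow_le (by norm_num) (lt_of_lt_of_le (by positivity) h), Real.rpow_natCast]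
  exact h

namespace EntropyMachine

variable {n a b d k : ℕ}

/-- Numbering the stages. -/
def phaseCode (D : ℕ) (hD : 0 < D) : Phase D → Fin 8 × Fin D
  | .vote => (0, ⟨0, hD⟩)
  | .tally => (1, ⟨0, hD⟩)
  | .prepare => (2, ⟨0, hD⟩)
  | .load t => (3, t)
  | .count t => (4, t)
  | .uncount t => (5, t)
  | .unload t => (6, t)
  | .finish => (7, ⟨0, hD⟩)

theorem phaseCode_injective (D : ℕ) (hD : 0 < D) : Function.Injective (phaseCode D hD) := by
  intro p q h
  cases p <;> cases q <;> simp_all [phaseCode]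

/-- Encoding the memory. -/
def memoryCode (s : Memory n a b d k) : (Fin 8 × Fin (2 ^ d)) × Fin n × ZMod (2 ^ a) ×
    ZMod (2 ^ a) × (WorkReg a b × ZMod (2 ^ d)) × (ZMod (2 ^ d) × ZMod (k + 1)) ×
    (ZMod (2 ^ d) × ZMod (k + 1)) :=
  (phaseCode _ (by positivity) s.phase, s.sym, s.cnt, s.rest, s.last, s.vote₀, s.vote₁)

theorem memoryCode_injective : Function.Injective (memoryCode (n := n) (a := a) (b := b) (d := d)
    (k := k)) := by
  intro s s' h
  simp only [memoryCode, Prod.mk.injEq] at h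
  exact Memory.ext (phaseCode_injective _ _ h.1) h.2.1 h.2.2.1 h.2.2.2.1 h.2.2.2.2.1 h.2.2.2.2.2.1
    h.2.2.2.2.2.2

instance : Finite (Memory n a b d k) := Finite.of_injective _ memoryCode_injective

theorem card_register : Fintype.card (WorkReg a b × ZMod (2 ^ d)) = 2 ^ (1 + 2 * a + b + d) := by
  simp only [Fintype.card_prod, Fintype.card_bool, ZMod.card]
  ring

theorem card_memory_le {c : ℕ} (hnb : n ≤ 2 ^ b) (hkc : k + 1 ≤ 2 ^ c) :
    Nat.card (Memory n a b d k) ≤ 2 ^ (4 + 4 * a + 2 * b + 4 * d + 2 * c) := by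
  refine (Nat.card_le_card_of_injective _ memoryCode_injective).trans ?_
  simp only [Nat.card_eq_fintype_card, Fintype.card_prod, Fintype.card_bool, ZMod.card,
    Fintype.card_fin]
  calc _ ≤ 8 * 2 ^ d * (2 ^ b * (2 ^ a * (2 ^ a * (2 * (2 ^ a * (2 ^ b * 2 ^ a)) * 2 ^ d *
        (2 ^ d * 2 ^ c * (2 ^ d * 2 ^ c)))))) := by gcongr
    _ = _ := by ring

end EntropyMachine

/-- The case of a stream in which at most one symbol can occur. -/
theorem exists_trivial_algorithm (n : ℕ) : ∃ A : QuantumStreamingAlgorithm n,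
    A.passes = 0 ∧ A.qubits = 0 ∧ A.bits = 0 ∧
      ∀ {m : ℕ} (x : Fin m → Fin n) (ε δ : ℝ), 0 < δ → A.IsApproximation x ε δ 0 := by
  let A : StreamMachine n Unit Unit :=
    { update := fun _ _ => (), gate := fun _ _ => 1, endGate := fun _ => 1,
      measures := fun _ => false, endUpdate := fun _ => (), outcomeUpdate := fun _ _ => (),
      output := fun _ => 0 }
  obtain ⟨B, h1, h2, h3, h4⟩ := A.exists_algorithm (k := 0) (b := 0) (by simp) (by simp) 0 () ()
  refine ⟨B, h1, h2, h3, fun x ε δ hδ => ?_⟩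
  rw [QuantumStreamingAlgorithm.IsApproximation, h4]
  simp [StreamMachine.weight, A, hδ.le]

theorem streamEntropy_eq_zero_of_le_one {m n : ℕ} (hm : 0 < m) (h : m = 1 ∨ n = 1)
    (x : Fin m → Fin n) : streamEntropy x = 0 := by
  refine Finset.sum_eq_zero fun i _ => ?_
  have : empiricalProb x i = 0 ∨ empiricalProb x i = 1 := by
    unfold empiricalProb
    rcases h with rfl | rfl
    · rcases Nat.le_one_iff_eq_zero_or_eq_one.1
        ((Finset.card_filter_le (Finset.univ : Finset (Fin 1)) fun j => x j = i).trans
          (by simp)) with h | h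
      · left; rw [h]; simp
      · right; rw [h]; simp
    · right
      rw [Finset.filter_true_of_mem fun j _ => Subsingleton.elim _ _, Finset.card_univ,
        Fintype.card_fin, div_self]
      exact_mod_cast hm.ne'
  rcases this with h | h <;> simp [h]

/-- The algorithm for very small error probability, which is deterministic. -/
theorem exists_exact_algorithm {m n : ℕ} {ε : ℝ} (hm : 1 < m) (hn : 1 < n) (hε : 0 < ε)
    (hε1 : ε < 1) : ∃ A : QuantumStreamingAlgorithm n, A.passes = n ∧
      (A.qubits : ℝ) + A.bits ≤
        10 * (Real.logb 2 m + Real.logb 2 n + Real.logb 2 (1 / ε)) ∧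
      ∀ (x : Fin m → Fin n) (δ : ℝ), 0 < δ → A.IsApproximation x ε δ (streamEntropy x) := by
  have hm' : (2 : ℝ) ≤ m := by exact_mod_cast hm
  have hn' : (2 : ℝ) ≤ n := by exact_mod_cast hn
  set G := ⌈(n * m : ℝ) / ε⌉₊ with hG
  set M := n * (G * m) + 1 with hM
  have hGge : (n * m : ℝ) / ε ≤ G := Nat.le_ceil _
  have hGle : (G : ℝ) ≤ 2 * ((n * m : ℝ) / ε) := by
    have h1 := (Nat.ceil_lt_add_one (show 0 ≤ (n * m : ℝ) / ε by positivity)).le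
    have h2 : 1 ≤ (n * m : ℝ) / ε := by
      rw [le_div_iff₀ hε]; nlinarith
    rw [hG]; linarith
  have hMle : (M : ℝ) ≤ 3 * (n ^ 2 * m ^ 2 / ε) := by
    have h2 : 1 ≤ (n ^ 2 * m ^ 2 : ℝ) / ε := by
      rw [le_div_iff₀ hε]
      nlinarith [mul_le_mul hn' hm' (by norm_num) (by positivity)]
    have h3 : (n : ℝ) * (G * m) ≤ 2 * (n ^ 2 * m ^ 2 / ε) := by
      calc (n : ℝ) * (G * m) ≤ n * (2 * ((n * m : ℝ) / ε) * m) := by gcongr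
        _ = _ := by ring
    rw [hM]; push_cast; linarith
  obtain ⟨c, hc1, hc2⟩ := exists_two_pow_bounds (x := (n + 1) * ((m + 1) * M)) (by positivity)
  have : NeZero M := ⟨by omega⟩
  obtain ⟨B, h1, h2, h3, h4⟩ := (ExactMachine.machine n m G M).exists_algorithm (k := 0) (b := c)
    (by simp) (by simpa [Nat.card_prod] using hc1) n (0, 0, 0) ()
  refine ⟨B, h1, ?_, fun x δ hδ => ?_⟩
  · rw [h2, h3, Nat.cast_zero, zero_add]
    have hcb : (2 : ℝ) ^ c ≤ 2 ^ 5 * (n ^ 3 * m ^ 3 * (1 / ε)) := by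
      have : (2 : ℝ) ^ c ≤ 2 * ((n + 1) * ((m + 1) * M)) := by exact_mod_cast hc2
      calc (2 : ℝ) ^ c ≤ 2 * ((n + 1) * ((m + 1) * M)) := this
        _ ≤ 2 * ((3 / 2 * n) * ((3 / 2 * m) * (3 * (n ^ 2 * m ^ 2 / ε)))) := by
            gcongr <;> linarith
        _ = 27 / 2 * (n ^ 3 * m ^ 3 * (1 / ε)) := by ring
        _ ≤ _ := by gcongr; norm_num
    have hlog := natCast_le_logb hcb
    rw [Real.logb_mul (by positivity) (by positivity), Real.logb_mul (by positivity) (by positivity),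
      Real.logb_mul (by positivity) (by positivity), Real.logb_pow, Real.logb_pow, Real.logb_pow,
      Real.logb_self_eq_one (by norm_num)] at hlog
    have hLm : 1 ≤ Real.logb 2 m := by
      rw [Real.le_logb_iff_rpow_le (by norm_num) (by positivity), Real.rpow_one]; exact hm'
    have hLn : 1 ≤ Real.logb 2 n := by
      rw [Real.le_logb_iff_rpow_le (by norm_num) (by positivity), Real.rpow_one]; exact hn'
    have hLe : 0 ≤ Real.logb 2 (1 / ε) :=
      Real.logb_nonneg (by norm_num) ((one_le_div hε).2 hε1.le)
    push_cast at hlog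
    linarith
  · rw [QuantumStreamingAlgorithm.IsApproximation, h4,
      ExactMachine.weight_eq_one (by omega) (by omega) hε hGge (by omega)]
    linarith

/-- The quantum algorithm, with a number `k` of repetitions. -/
theorem exists_quantum_algorithm {m n k : ℕ} {ε : ℝ} (hm : 1 < m) (hn : 1 < n) (hkn : k ≤ n)
    (hε : 0 < ε) (hε1 : ε < 1) : ∃ A : QuantumStreamingAlgorithm n,
      (A.passes : ℝ) ≤ k * (12010 * (√(Real.logb 2 m) / ε)) + 2 ∧
      (A.qubits : ℝ) + A.bits ≤
        100 * (Real.logb 2 m + Real.logb 2 n + Real.logb 2 (1 / ε)) ∧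
      ∀ (x : Fin m → Fin n) (δ : ℝ), 1 / 2 ^ k ≤ δ → A.IsApproximation x ε δ (streamEntropy x) := by
  have hm' : (2 : ℝ) ≤ m := by exact_mod_cast hm
  have hn' : (2 : ℝ) ≤ n := by exact_mod_cast hn
  have hLm : 1 ≤ Real.logb 2 m := by
    rw [Real.le_logb_iff_rpow_le (by norm_num) (by positivity), Real.rpow_one]; exact hm'
  have hLn : 1 ≤ Real.logb 2 n := by
    rw [Real.le_logb_iff_rpow_le (by norm_num) (by positivity), Real.rpow_one]; exact hn'
  have hLe : 0 ≤ Real.logb 2 (1 / ε) :=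
    Real.logb_nonneg (by norm_num) ((one_le_div hε).2 hε1.le)
  have hLle : Real.logb 2 m ≤ m := by
    rw [Real.logb_le_iff_le_rpow (by norm_num) (by positivity), Real.rpow_natCast]
    exact_mod_cast Nat.lt_two_pow_self.le
  set L := Real.logb 2 m with hL
  have hsq1 : 1 ≤ √L := Real.one_le_sqrt.2 hLm
  have hsqm : √L ≤ m := by
    have := Real.sq_sqrt (show 0 ≤ L by linarith)
    nlinarith
  set s := √L / ε with hs
  have hs1 : 1 ≤ s := by rw [hs, le_div_iff₀ hε]; linarith
  -- The constant 1500 exceeds `20 * √128 * 2 * π`, which is what `hD` below requires.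
  obtain ⟨d, hd1, hd2⟩ := exists_two_pow_bounds (x := ⌈1500 * s⌉₊)
    (Nat.ceil_pos.2 (by linarith))
  have hDge : 1500 * s ≤ ((2 ^ d : ℕ) : ℝ) := (Nat.le_ceil _).trans (by exact_mod_cast hd1)
  have hDle : ((2 ^ d : ℕ) : ℝ) ≤ 3002 * s := by
    have h1 := (Nat.ceil_lt_add_one (show 0 ≤ 1500 * s by linarith)).le
    have h2 : ((2 ^ d : ℕ) : ℝ) ≤ 2 * (⌈1500 * s⌉₊ : ℝ) := by exact_mod_cast hd2
    linarith
  -- With `m + 1` in place of `m`, counts up to `m` itself fit without wrapping around.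
  obtain ⟨a, ha1, ha2⟩ := exists_two_pow_bounds (x := m + 1) (by omega)
  obtain ⟨b, hb1, hb2⟩ := exists_two_pow_bounds (x := n) (by omega)
  obtain ⟨c, hc1, hc2⟩ := exists_two_pow_bounds (x := k + 1) (by omega)
  have hd3 : 2 < 2 ^ d := by
    have : (2 : ℝ) < ((2 ^ d : ℕ) : ℝ) := by linarith
    exact_mod_cast this
  have hD : (2 * Real.pi / (2 ^ d : ℕ)) ^ 2 ≤ (ε / 20) ^ 2 / (128 * L) := by
    have hpi := Real.pi_lt_d2
    have hpi0 := Real.pi_pos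
    have h1 : 2 * Real.pi / (2 ^ d : ℕ) ≤ 6.3 / (1500 * s) := by
      gcongr
      linarith
    calc (2 * Real.pi / (2 ^ d : ℕ)) ^ 2 ≤ (6.3 / (1500 * s)) ^ 2 :=
          pow_le_pow_left₀ (by positivity) h1 2
      _ = 6.3 ^ 2 / 1500 ^ 2 * (ε ^ 2 / L) := by
          rw [hs, div_pow, mul_pow, div_pow, Real.sq_sqrt (by linarith)]
          field_simp
      _ ≤ 1 / (400 * 128) * (ε ^ 2 / L) :=
          mul_le_mul_of_nonneg_right (by norm_num) (by positivity)
      _ = _ := by field_simp; norm_num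
  let z₀ : Fin n := ⟨0, by omega⟩
  let q₀ : WorkReg a b × ZMod (2 ^ d) := ((false, 0, 0, 0), 0)
  obtain ⟨B, h1, h2, h3, h4⟩ := (EntropyMachine.machine n m a b d k (ε / 5)).exists_algorithm
    EntropyMachine.card_register (EntropyMachine.card_memory_le hb1 hc1)
    (k * EntropyMachine.runLength d + 2) (EntropyMachine.initial z₀ q₀) q₀
  refine ⟨B, ?_, ?_, fun x δ hδ => ?_⟩
  · rw [h1, EntropyMachine.runLength]
    push_cast at hDle ⊢
    -- A run takes at most `4 * 3002 * s + 2` passes, and the 2 is absorbed because `1 ≤ s`.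
    have : (k : ℝ) * (4 * 2 ^ d + 2) ≤ k * (12010 * s) := by
      gcongr
      linarith
    linarith
  · rw [h2, h3]
    have ea : (a : ℝ) ≤ 2 + L := by
      have : (2 : ℝ) ^ a ≤ 2 ^ 2 * m := by
        have : (2 : ℝ) ^ a ≤ 2 * (m + 1) := by exact_mod_cast ha2
        linarith
      have := natCast_le_logb this
      rw [Real.logb_mul (by positivity) (by positivity), Real.logb_pow,
        Real.logb_self_eq_one (by norm_num)] at this
      push_cast at this
      linarith
    have eb : (b : ℝ) ≤ 1 + Real.logb 2 n := by
      have : (2 : ℝ) ^ b ≤ 2 * n := by exact_mod_cast hb2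
      have := natCast_le_logb this
      rwa [Real.logb_mul (by positivity) (by positivity),
        Real.logb_self_eq_one (by norm_num)] at this
    -- Here `k ≤ n` pays for the vote counters, whose size would otherwise depend on `δ`.
    have ec : (c : ℝ) ≤ 2 + Real.logb 2 n := by
      have : (2 : ℝ) ^ c ≤ 2 ^ 2 * n := by
        have h1 : (2 : ℝ) ^ c ≤ 2 * (k + 1) := by exact_mod_cast hc2
        have h2 : (k : ℝ) ≤ n := by exact_mod_cast hkn
        linarith
      have := natCast_le_logb this
      rw [Real.logb_mul (by positivity) (by positivity), Real.logb_pow,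
        Real.logb_self_eq_one (by norm_num)] at this
      push_cast at this
      linarith
    -- The crude bound `√L ≤ m` is enough for the size of the clock register.
    have ed : (d : ℝ) ≤ 12 + L + Real.logb 2 (1 / ε) := by
      have : (2 : ℝ) ^ d ≤ 2 ^ 12 * m * (1 / ε) := by
        push_cast at hDle
        calc (2 : ℝ) ^ d ≤ 3002 * s := hDle
          _ = 3002 * √L * (1 / ε) := by rw [hs]; ring
          _ ≤ _ := by gcongr; norm_num
      have := natCast_le_logb this
      rw [Real.logb_mul (by positivity) (by positivity), Real.logb_mul (by positivity) (by positivity),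
        Real.logb_pow, Real.logb_self_eq_one (by norm_num)] at this
      push_cast at this
      linarith
    push_cast
    linarith
  · rw [QuantumStreamingAlgorithm.IsApproximation, h4]
    have := EntropyMachine.one_sub_le_weight (k := k) hd3 hm (by omega : m < 2 ^ a) hb1 hε hε1 hD
      x z₀ q₀
    linarith

theorem theorem1 :
    ∃ C : ℝ, 0 < C ∧
      ∀ (m n : ℕ) (ε δ : ℝ), 0 < m → 0 < n → 0 < ε → ε < 1 → 0 < δ → δ < 1 →
        ∃ A : QuantumStreamingAlgorithm n,
          (A.passes : ℝ) ≤ C * (max 1 (Real.logb 2 (1 / δ)) * √(Real.logb 2 m) / ε) ∧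
          (A.qubits : ℝ) + (A.bits : ℝ) ≤
            C * (Real.logb 2 m + Real.logb 2 n + Real.logb 2 (1 / ε)) ∧
          ∀ x : Fin m → Fin n, A.IsApproximation x ε δ (streamEntropy x) := by
  refine ⟨30000, by norm_num, fun m n ε δ hm hn hε hε1 hδ hδ1 => ?_⟩
  have hm' : (1 : ℝ) ≤ m := by exact_mod_cast hm
  have hn' : (1 : ℝ) ≤ n := by exact_mod_cast hn
  have hLm : 0 ≤ Real.logb 2 m := Real.logb_nonneg (by norm_num) hm'
  have hLn : 0 ≤ Real.logb 2 n := Real.logb_nonneg (by norm_num) hn'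
  have hLe : 0 ≤ Real.logb 2 (1 / ε) :=
    Real.logb_nonneg (by norm_num) ((one_le_div hε).2 hε1.le)
  -- For `m = 1` the pass bound is zero, so an algorithm with no passes is needed; for `n = 1` the
  -- entropy vanishes as well.
  by_cases htriv : m = 1 ∨ n = 1
  · obtain ⟨A, h1, h2, h3, h4⟩ := exists_trivial_algorithm n
    refine ⟨A, ?_, ?_, fun x => ?_⟩
    · rw [h1, Nat.cast_zero]; positivity
    · rw [h2, h3, Nat.cast_zero, add_zero]; positivity
    · rw [streamEntropy_eq_zero_of_le_one hm htriv x]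
      exact h4 x ε δ hδ
  · have hm2 : 1 < m := by omega
    have hn2 : 1 < n := by omega
    have hLm1 : 1 ≤ Real.logb 2 m := by
      rw [Real.le_logb_iff_rpow_le (by norm_num) (by positivity), Real.rpow_one]
      exact_mod_cast hm2
    set s := √(Real.logb 2 m) / ε with hs
    have hs1 : 1 ≤ s := by
      rw [hs, le_div_iff₀ hε]
      linarith [Real.one_le_sqrt.2 hLm1]
    set r := max 1 (Real.logb 2 (1 / δ)) with hr
    have hr1 : 1 ≤ r := le_max_left _ _
    rw [mul_div_assoc, ← hs]
    -- In the first case `n` passes are within the bound, so certainty is affordable; in the second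
    -- the number of repetitions is at most `n`.
    by_cases hcase : (n : ℝ) ≤ Real.logb 2 (1 / δ)
    · obtain ⟨A, h1, h2, h3⟩ := exists_exact_algorithm hm2 hn2 hε hε1
      refine ⟨A, ?_, h2.trans ?_, fun x => h3 x δ hδ⟩
      · rw [h1]
        have : (n : ℝ) ≤ r := hcase.trans (le_max_right _ _)
        nlinarith
      · gcongr
        norm_num
    · push Not at hcase
      have hkn : ⌈r⌉₊ ≤ n := Nat.ceil_le.2 (max_le hn' hcase.le)
      obtain ⟨A, h1, h2, h3⟩ := exists_quantum_algorithm (k := ⌈r⌉₊) hm2 hn2 hkn hε hε1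
      refine ⟨A, h1.trans ?_, h2.trans ?_, fun x => h3 x δ ?_⟩
      -- Rounding `r ≥ 1` up at most doubles it, so `2 * 12010 + 2` is the pass constant needed,
      -- below 30000.
      · have hk : ((⌈r⌉₊ : ℕ) : ℝ) ≤ 2 * r := by
          linarith [(Nat.ceil_lt_add_one (show 0 ≤ r by linarith)).le]
        have hrs : 1 ≤ r * s := by nlinarith
        calc ((⌈r⌉₊ : ℕ) : ℝ) * (12010 * s) + 2 ≤ 2 * r * (12010 * s) + 2 * (r * s) := by
              gcongr
              linarith
          _ ≤ 30000 * (r * s) := by linarith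
      · gcongr
        norm_num
      · have hle : Real.logb 2 (1 / δ) ≤ (⌈r⌉₊ : ℕ) := (le_max_right _ _).trans (Nat.le_ceil r)
        rw [Real.logb_le_iff_le_rpow (by norm_num) (by positivity), Real.rpow_natCast] at hle
        rw [div_le_iff₀ (by positivity)]
        rw [div_le_iff₀ hδ] at hle
        linarith
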